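/- Let $k\ge 0$ and $0<\alpha\le 1$. For $x=(x_1,x_2)\in\mathbb R^2$ and $\tau>0$ put $$E^k_\alpha(x;\tau)=\sum_{m=0}^\infty\frac{\{\tau(x_1+ix_2)\}^m}{\Gamma(\alpha m+1)}\left(\frac{2}{k|x|}\right)^m m!\,J_m(k|x|),\qquad J_m(t)=\left(\frac t2\right)^m\sum_{n=0}^\infty\frac{(-1)^n}{(m+n)!\,n!}\left(\frac t2\right)^{2n},$$ where $(2/t)^m m!\,J_m(t)$ is understood as its limit $1$ at $t=0$. Let $R>0$ and $\epsilon>0$, and let $\Omega$ be the set of all $x\in\mathbb R^2$ in the open sector $x_1>|x|\cos(\pi\alpha/2)$ (that is, $x\neq0$ and $|\arg(x_1+ix_2)|<\pi\alpha/2$) with $R^{-1}\le|x|\le R$ and $\mathrm{Re}\,(x_1+ix_2)^{1/\alpha}\ge\epsilon$, where the power is the principal one. Then, as $\tau\to\infty$, $$E^k_\alpha(x;\tau)=\frac1\alpha e^{\tau^{1/\alpha}(x_1+ix_2)^{1/\alpha}}\left\{1+O\!\left(\frac1{\tau^{1/\alpha}}\right)\right\},$$ and for $j=1,2$ (all the functions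 differentiated being differentiable at the points of $\Omega$) $$\frac{\partial}{\partial x_j}E^k_\alpha(x;\tau)=\frac{\partial}{\partial x_j}\left\{\frac1\alpha e^{\tau^{1/\alpha}(x_1+ix_2)^{1/\alpha}}\right\}\left\{1+O\!\left(\frac1{\tau^{1/\alpha}}\right)\right\},$$ uniformly for $x\in\Omega$: the constants in the $O$-terms, and the threshold from which on the bounds hold, depend only on $k,\alpha,R,\epsilon$. In particular $E^k_\alpha$ grows exponentially on $\Omega$: for all sufficiently large $\tau$ and all $x\in\Omega$, $|E^k_\alpha(x;\tau)|\ge\frac1{2\alpha}e^{\epsilon\tau^{1/\alpha}}$. -/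

import Mathlib

open scoped Nat

noncomputable section

namespace ModifiedMittagLeffler

/-- The Euclidean plane `ℝ²`; its coordinates `x₁, x₂` are `x 0, x 1`. -/
abbrev Plane : Type := EuclideanSpace ℝ (Fin 2)

/-- The complex number `x₁ + i x₂`. -/
def toComplex (x : Plane) : ℂ := (x 0 : ℂ) + Complex.I * (x 1 : ℂ)

/-- The Bessel function `J_m(t) = (t/2)^m ∑ₙ (-1)ⁿ / ((m+n)! n!) (t/2)^(2n)`. -/
def besselJ (m : ℕ) (t : ℝ) : ℝ :=
  (t / 2) ^ m * ∑' n : ℕ, (-1 : ℝ) ^ n / ((m + n)! * n ! : ℝ) * (t / 2) ^ (2 * n)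

/-- The normalized Bessel function `(2/t)^m m! J_m(t)`, with its limit value `1` at `t = 0`. -/
def besselHat (m : ℕ) (t : ℝ) : ℝ :=
  if t = 0 then 1 else (2 / t) ^ m * (m ! : ℝ) * besselJ m t

/-- The modified Mittag-Leffler function
`E^k_α(x;τ) = ∑ₘ (τ(x₁ + i x₂))^m / Γ(αm+1) · (2/(k|x|))^m m! J_m(k|x|)`. -/
def modML (k α τ : ℝ) (x : Plane) : ℂ :=
  ∑' m : ℕ, ((τ : ℂ) * toComplex x) ^ m / (Real.Gamma (α * m + 1) : ℂ) *
    (besselHat m (k * ‖x‖) : ℂ)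

/-- The function `(1/α) exp(τ^(1/α) (x₁ + i x₂)^(1/α))`, with the principal branch of the power. -/
def leadingTerm (α τ : ℝ) (x : Plane) : ℂ :=
  (1 / α : ℂ) *
    Complex.exp (((τ ^ (1 / α) : ℝ) : ℂ) * toComplex x ^ ((1 / α : ℝ) : ℂ))

/-- The open cone `{x : x₁ > |x| cos(πα/2)}` about the positive `x₁`-axis, i.e. the sector
`x ≠ 0`, `|arg (x₁ + i x₂)| < πα/2`. -/
def cone (α : ℝ) : Set Plane := {x | ‖x‖ * Real.cos (Real.pi * α / 2) < x 0}

/-- The set of `x` in the cone with `R⁻¹ ≤ |x| ≤ R` and `Re (x₁ + i x₂)^(1/α) ≥ ε`. -/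
def region (α R ε : ℝ) : Set Plane :=
  {x | x ∈ cone α ∧ R⁻¹ ≤ ‖x‖ ∧ ‖x‖ ≤ R ∧ ε ≤ (toComplex x ^ ((1 / α : ℝ) : ℂ)).re}

/-- The partial derivative `∂f/∂x_j`. -/
def partialDeriv (j : Fin 2) (f : Plane → ℂ) (x : Plane) : ℂ :=
  lineDeriv ℝ f x (EuclideanSpace.single j 1)

end ModifiedMittagLeffler

end

noncomputable section

namespace ModifiedMittagLeffler

open MeasureTheory Set Filter Topology

/-! The Bessel factors are moments. With q = (k|x|/2)², the beta integral gives m! (2/t)^m J_m(t) =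
1 + ∫₀¹ s^m κ_q(s) ds for a bounded kernel κ_q (`besselSeries_eq_integral`). Hence E^k_α is E_α(w) +
∫₀¹ E_α(sw) κ_q(s) ds, where w = τ(x₁ + i x₂) and E_α is the classical Mittag-Leffler function
(`twoVarML_eq_integral`).

For E_α, sum a geometric series under the inverse Laplace transform of powers: E_α(w) - 1 is (1/2πi)
∫ e^ζ w / (ζ(ζ^α - w)) dζ over a vertical line far to the right. Put w = v^α with Re v > 0 and
subtract 1/α times the same formula for E_1(v) = e^v. The poles at ζ = v cancel, the remaining
integrand is holomorphic in the right half-plane, and the line can be moved to Re ζ = 1. This gives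
E_α(v^α) = e^v/α + O(1 + |v|) (`exists_norm_mittagLeffler_sub_exp_le`).

In the moment integral s v^α = (s^(1/α) v)^α and s^(1/α) ≤ s, so the integrand is at most a multiple
of e^(s Re v) plus O(1 + |v|), and integration in s gains a factor 1/Re v. With v = T z^(1/α), T =
τ^(1/α) and Re z^(1/α) ≥ ε, the relative error is O(1/T).

For the derivatives, the estimate is proved for complex w and q independently, so it persists on a
complex disc of uniform radius along each line through x. Cauchy's inequality then bounds the
derivative of the relative error by O(1/T) (`exists_line_expansion`), while the logarithmic
derivative of the leading term stays away from 0. -/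

/-! ### Laplace transform of powers and its inversion -/

lemma integrableOn_rpow_mul_exp_neg {a c : ℝ} (ha : 0 < a) (hc : 0 < c) :
    IntegrableOn (fun t : ℝ => t ^ (a - 1) * Real.exp (-(c * t))) (Ioi 0) := by
  have := integrableOn_rpow_mul_exp_neg_mul_rpow (p := 1) (s := a - 1) (b := c) (by linarith)
    (by norm_num) hc
  simpa [neg_mul] using this

/-- The Laplace transform of a power, extended from positive to complex arguments. -/
lemma integral_rpow_mul_cexp_neg {a : ℝ} (ha : 0 < a) {z : ℂ} (hz : 0 < z.re) :
    ∫ t in Ioi (0 : ℝ), ((t ^ (a - 1) : ℝ) : ℂ) * Complex.exp (-(z * t)) =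
      (Real.Gamma a : ℂ) * z ^ (-a : ℂ) := by
  set H : Set ℂ := {z | 0 < z.re} with hH
  have hHo : IsOpen H := isOpen_lt continuous_const Complex.continuous_re
  have hHc : IsPreconnected H := (convex_halfSpace_re_gt 0).isPreconnected
  set f : ℂ → ℂ := fun z => ∫ t in Ioi (0 : ℝ), ((t ^ (a - 1) : ℝ) : ℂ) * Complex.exp (-(z * t))
  set g : ℂ → ℂ := fun z => (Real.Gamma a : ℂ) * z ^ (-a : ℂ)
  have hcont : ∀ z : ℂ, ∀ b : ℝ, ContinuousOn (fun t : ℝ => ((t ^ (b - 1) : ℝ) : ℂ) *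
      Complex.exp (-(z * t))) (Ioi 0) := by
    intro z b t ht
    have : (0 : ℝ) < t := ht
    have h1 : ContinuousAt (fun t : ℝ => t ^ (b - 1)) t :=
      Real.continuousAt_rpow_const _ _ (Or.inl this.ne')
    have h2 : ContinuousAt (fun t : ℝ => Complex.exp (-(z * t))) t := by fun_prop
    exact ((Complex.continuous_ofReal.continuousAt.comp h1).mul h2).continuousWithinAt
  have hnorm : ∀ z : ℂ, ∀ b t : ℝ, 0 < t → ‖((t ^ (b - 1) : ℝ) : ℂ) * Complex.exp (-(z * t))‖ =
      t ^ (b - 1) * Real.exp (-(z.re * t)) := by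
    intro z b t ht
    rw [norm_mul, Complex.norm_real, Complex.norm_exp, Real.norm_of_nonneg (by positivity)]
    simp
  have hf : DifferentiableOn ℂ f H := by
    intro z₀ hz₀
    have hz₀' : 0 < z₀.re := hz₀
    -- Differentiation under the integral: on Re z > Re z₀ / 2 the z-derivative is dominated by the
    -- integrand with decay rate Re z₀ / 2.
    have key := hasDerivAt_integral_of_dominated_loc_of_deriv_le
      (μ := volume.restrict (Ioi (0 : ℝ)))
      (F := fun z (t : ℝ) => ((t ^ (a - 1) : ℝ) : ℂ) * Complex.exp (-(z * t)))
      (F' := fun z (t : ℝ) => -(((t ^ (a + 1 - 1) : ℝ) : ℂ) * Complex.exp (-(z * t))))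
      (bound := fun t => t ^ (a + 1 - 1) * Real.exp (-(z₀.re / 2 * t)))
      (x₀ := z₀) (s := {z | z₀.re / 2 < z.re})
      ((isOpen_lt continuous_const Complex.continuous_re).mem_nhds (by
        show z₀.re / 2 < z₀.re; linarith))
      (Eventually.of_forall fun z => (hcont z a).aestronglyMeasurable measurableSet_Ioi)
      ?_ ((hcont z₀ (a + 1)).neg.aestronglyMeasurable measurableSet_Ioi) ?_
      (integrableOn_rpow_mul_exp_neg (by linarith) (by linarith)) ?_
    · exact key.2.differentiableAt.differentiableWithinAt
    · refine (integrableOn_rpow_mul_exp_neg ha hz₀').mono'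
        ((hcont z₀ a).aestronglyMeasurable measurableSet_Ioi) ?_
      filter_upwards [ae_restrict_mem measurableSet_Ioi] with t ht
      exact (hnorm z₀ a t ht).le
    · filter_upwards [ae_restrict_mem measurableSet_Ioi] with t ht z hz
      rw [norm_neg, hnorm z (a + 1) t ht]
      have : (0 : ℝ) < t := ht
      have hz' : z₀.re / 2 < z.re := hz
      gcongr
    · filter_upwards [ae_restrict_mem measurableSet_Ioi] with t ht z hz
      have ht' : (0 : ℝ) < t := ht
      have h1 : HasDerivAt (fun z : ℂ => Complex.exp (-(z * t))) (Complex.exp (-(z * t)) * -t) z := by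
        have := ((hasDerivAt_id z).mul_const (t : ℂ)).neg.cexp
        simpa using this
      refine (h1.const_mul ((t ^ (a - 1) : ℝ) : ℂ)).congr_deriv ?_
      have : t ^ (a + 1 - 1) = t ^ (a - 1) * t := by
        rw [← Real.rpow_add_one ht'.ne']; ring_nf
      rw [this]; push_cast; ring
  have hg : DifferentiableOn ℂ g H := by
    intro z hz
    have : z ∈ Complex.slitPlane := Or.inl hz
    exact ((differentiableAt_id.cpow_const this).const_mul _).differentiableWithinAt
  have hfg : ∀ r : ℝ, 0 < r → f r = g r := by
    intro r hr
    have := Complex.integral_cpow_mul_exp_neg_mul_Ioi (a := a) (r := r) (by simpa) hr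
    simp only [f, g]
    rw [Complex.Gamma_ofReal, one_div, Complex.inv_cpow _ _ (by
      rw [Complex.arg_ofReal_of_nonneg hr.le]; exact Real.pi_pos.ne)] at this
    rw [Complex.cpow_neg, mul_comm _ (_)⁻¹, ← this]
    refine setIntegral_congr_fun measurableSet_Ioi fun t ht => ?_
    have ht' : (0 : ℝ) < t := ht
    rw [Complex.ofReal_cpow ht'.le]; push_cast; rfl
  -- Identity theorem: both sides agree at the reals 1 + 1/(n+1), which accumulate at 1.
  have := (hf.analyticOnNhd hHo).eqOn_of_preconnected_of_frequently_eq (hg.analyticOnNhd hHo)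
    hHc (show (1 : ℂ) ∈ H by simp [hH]) ?_
  · exact this hz
  · have hseq : Tendsto (fun n : ℕ => ((1 + 1 / ((n : ℝ) + 1) : ℝ) : ℂ)) atTop (𝓝[≠] 1) := by
      rw [tendsto_nhdsWithin_iff]
      constructor
      · have := (tendsto_one_div_add_atTop_nhds_zero_nat (𝕜 := ℝ)).const_add 1
        rw [add_zero] at this
        exact_mod_cast (Complex.continuous_ofReal.tendsto 1).comp this
      · refine Eventually.of_forall fun n => ?_
        have : (0 : ℝ) < 1 / ((n : ℝ) + 1) := by positivity
        simp only [mem_compl_iff, mem_singleton_iff]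
        intro h
        have h2 : (1 + 1 / ((n : ℝ) + 1) : ℝ) = 1 := by exact_mod_cast h
        linarith
    refine hseq.frequently (Eventually.of_forall fun n => hfg _ (by positivity)).frequently

lemma norm_vertical_cpow {c : ℝ} (hc : 0 < c) (a y : ℝ) :
    ‖((c : ℂ) + y * Complex.I) ^ (-a : ℂ)‖ = ‖(c : ℂ) + y * Complex.I‖ ^ (-a) := by
  have h0 : ((c : ℂ) + y * Complex.I) ≠ 0 := by
    intro h
    have := congrArg Complex.re h
    simp at this; exact hc.ne' this
  rw [← Complex.ofReal_neg, Complex.norm_cpow_of_ne_zero h0]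
  simp

lemma continuous_vertical_cpow {c : ℝ} (hc : 0 < c) (s : ℂ) :
    Continuous fun y : ℝ => ((c : ℂ) + y * Complex.I) ^ s := by
  refine continuous_iff_continuousAt.2 fun y => ?_
  refine ContinuousAt.cpow (by fun_prop) continuousAt_const (Or.inl ?_)
  simpa using hc

lemma integrable_vertical_norm_rpow {a c : ℝ} (ha : 1 < a) (hc : 0 < c) :
    Integrable fun y : ℝ => ‖(c : ℂ) + y * Complex.I‖ ^ (-a) := by
  have h := integrable_rpow_neg_one_add_norm_sq (E := ℝ) (μ := volume) (r := a) (by simpa)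
  have h2 := (h.comp_mul_left' (inv_ne_zero hc.ne')).const_mul (c ^ (-a))
  refine h2.congr (Eventually.of_forall fun y => ?_)
  simp only
  have e : ‖(c : ℂ) + y * Complex.I‖ = c * (1 + ‖c⁻¹ * y‖ ^ 2) ^ (1 / 2 : ℝ) := by
    rw [← Real.sqrt_eq_rpow, Complex.norm_def, Complex.normSq_add_mul_I,
      ← Real.sqrt_sq hc.le, ← Real.sqrt_mul (by positivity), Real.sqrt_sq hc.le]
    congr 1
    rw [Real.norm_eq_abs, sq_abs]; field_simp
  rw [e, Real.mul_rpow hc.le (by positivity), ← Real.rpow_mul (by positivity)]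
  congr 2; ring

/-- The inverse Laplace transform of a power: `∫ e^ζ ζ^(-a) = 2π i / Γ(a)` over a vertical line. -/
lemma integral_vertical_exp_mul_cpow {a c : ℝ} (ha : 1 < a) (hc : 0 < c) :
    ∫ y : ℝ, Complex.exp ((c : ℂ) + y * Complex.I) * ((c : ℂ) + y * Complex.I) ^ (-a : ℂ) =
      2 * Real.pi / (Real.Gamma a : ℂ) := by
  have ha0 : 0 < a := by linarith
  -- The Fourier transform of f is Γ(a)(c + 2πiw)^(-a), so the claim is Fourier inversion at the
  -- point 1. The condition a > 1 makes f continuous at 0 and its transform integrable.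
  set f : ℝ → ℂ := (Ioi (0 : ℝ)).indicator
    fun t => ((t ^ (a - 1) : ℝ) : ℂ) * Complex.exp (-((c : ℂ) * t)) with hfdef
  have hfc : Continuous f := by
    have : f = fun t => (((max t 0) ^ (a - 1) : ℝ) : ℂ) * Complex.exp (-((c : ℂ) * t)) := by
      ext t
      by_cases ht : 0 < t
      · rw [hfdef, indicator_of_mem (by exact ht), max_eq_left ht.le]
      · rw [hfdef, indicator_of_notMem (by exact ht), max_eq_right (not_lt.1 ht),
          Real.zero_rpow (by linarith)]; simp
    rw [this]
    have h1 : Continuous fun t : ℝ => (max t 0) ^ (a - 1) :=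
      (continuous_id.max continuous_const).rpow_const fun _ => Or.inr (by linarith)
    exact (Complex.continuous_ofReal.comp h1).mul (by fun_prop)
  have hfi : Integrable f := by
    rw [hfdef, integrable_indicator_iff measurableSet_Ioi]
    refine (integrableOn_rpow_mul_exp_neg ha0 hc).ofReal.congr ?_
    refine Eventually.of_forall fun t => ?_
    simp
  have hF : ∀ w : ℝ, FourierTransform.fourier f w =
      (Real.Gamma a : ℂ) * ((c : ℂ) + (2 * Real.pi * w : ℝ) * Complex.I) ^ (-a : ℂ) := by
    intro w
    rw [Real.fourier_real_eq_integral_exp_smul,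
      ← integral_rpow_mul_cexp_neg ha0 (z := (c : ℂ) + (2 * Real.pi * w : ℝ) * Complex.I)
        (by simpa using hc), ← integral_indicator measurableSet_Ioi]
    congr 1; ext t
    by_cases ht : t ∈ Ioi (0 : ℝ)
    · rw [hfdef, indicator_of_mem ht, indicator_of_mem ht, smul_eq_mul, mul_left_comm,
        ← Complex.exp_add]
      congr 2; push_cast; ring
    · rw [hfdef, indicator_of_notMem ht, indicator_of_notMem ht, smul_zero]
  have hFi : Integrable (FourierTransform.fourier f) := by
    have h1 : Integrable fun y : ℝ => (Real.Gamma a : ℂ) *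
        ((c : ℂ) + (y : ℝ) * Complex.I) ^ (-a : ℂ) := by
      refine Integrable.const_mul ?_ _
      refine (integrable_vertical_norm_rpow ha hc).mono'
        (continuous_vertical_cpow hc _).aestronglyMeasurable ?_
      exact Eventually.of_forall fun y => (norm_vertical_cpow hc a y).le
    refine (h1.comp_mul_left' (show 2 * Real.pi ≠ 0 by positivity)).congr ?_
    exact Eventually.of_forall fun w => (hF w).symm
  have inv := congrFun (hfc.fourierInv_fourier_eq hfi hFi) 1
  rw [Real.fourierInv_eq'] at inv
  have hG : (Real.Gamma a : ℂ) ≠ 0 := by exact_mod_cast (Real.Gamma_pos_of_pos ha0).ne'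
  have e1 : f 1 = Complex.exp (-c) := by
    rw [hfdef, indicator_of_mem (by simp)]; simp
  rw [e1] at inv
  have e2 : ∀ w : ℝ, Complex.exp (((2 * Real.pi * inner ℝ w 1 : ℝ) : ℂ) * Complex.I) •
      FourierTransform.fourier f w = (fun y : ℝ => Complex.exp (y * Complex.I) *
        ((Real.Gamma a : ℂ) * ((c : ℂ) + (y : ℝ) * Complex.I) ^ (-a : ℂ))) ((2 * Real.pi) * w) := by
    intro w
    rw [hF]; simp
  simp_rw [e2] at inv
  rw [Measure.integral_comp_mul_left (fun y : ℝ => Complex.exp (y * Complex.I) *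
        ((Real.Gamma a : ℂ) * ((c : ℂ) + (y : ℝ) * Complex.I) ^ (-a : ℂ))),
    abs_of_pos (by positivity)] at inv
  have e3 : ∀ y : ℝ, Complex.exp ((c : ℂ) + y * Complex.I) *
      ((c : ℂ) + y * Complex.I) ^ (-a : ℂ) = (Complex.exp c / Real.Gamma a) *
      (Complex.exp (y * Complex.I) *
        ((Real.Gamma a : ℂ) * ((c : ℂ) + (y : ℝ) * Complex.I) ^ (-a : ℂ))) := by
    intro y; rw [Complex.exp_add]; field_simp
  simp_rw [e3]
  rw [integral_const_mul]
  have hpi : ((2 * Real.pi : ℝ) : ℂ) ≠ 0 := by exact_mod_cast (by positivity : (2 * Real.pi) ≠ 0)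
  have inv' : ∫ y : ℝ, Complex.exp (y * Complex.I) *
        ((Real.Gamma a : ℂ) * ((c : ℂ) + (y : ℝ) * Complex.I) ^ (-a : ℂ)) =
      (2 * Real.pi : ℝ) * Complex.exp (-c) := by
    rw [← inv, Complex.real_smul, ← mul_assoc, ← Complex.ofReal_mul, mul_inv_cancel₀
      (by positivity), Complex.ofReal_one, one_mul]
  rw [inv', Complex.exp_neg]
  field_simp [Complex.exp_ne_zero]
  push_cast; ring

/-! ### The classical Mittag-Leffler function and its contour integral -/

/-- The classical Mittag-Leffler function `E_α(w) = ∑ₘ w^m / Γ(αm+1)`. -/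
def mittagLeffler (α : ℝ) (w : ℂ) : ℂ := ∑' m : ℕ, w ^ m / (Real.Gamma (α * m + 1) : ℂ)

/-- Only the part x > X of the Gamma integral is kept, where x^(s-1) ≥ X^(s-1). As X is free,
Γ(αm+1) outgrows every geometric sequence. -/
lemma rpow_mul_exp_neg_le_Gamma {s X : ℝ} (hs : 1 ≤ s) (hX : 0 < X) :
    X ^ (s - 1) * Real.exp (-X) ≤ Real.Gamma s := by
  rw [Real.Gamma_eq_integral (by linarith)]
  have hint := Real.GammaIntegral_convergent (s := s) (by linarith)
  calc X ^ (s - 1) * Real.exp (-X)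
      = ∫ x in Ioi X, Real.exp (-x) * X ^ (s - 1) := by
        rw [integral_mul_const, integral_exp_neg_Ioi, mul_comm]
    _ ≤ ∫ x in Ioi X, Real.exp (-x) * x ^ (s - 1) := by
        refine setIntegral_mono_on ((integrableOn_exp_neg_Ioi X).mul_const _)
          (hint.mono_set (Ioi_subset_Ioi hX.le)) measurableSet_Ioi fun x hx => ?_
        have : X < x := hx
        gcongr
    _ ≤ ∫ x in Ioi 0, Real.exp (-x) * x ^ (s - 1) := by
        refine setIntegral_mono_set hint ?_ (Ioi_subset_Ioi hX.le).eventuallyLE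
        filter_upwards [ae_restrict_mem measurableSet_Ioi] with x hx
        have : (0 : ℝ) < x := hx
        positivity

lemma Gamma_arg_pos {α : ℝ} (hα : 0 < α) (m : ℕ) : 0 < Real.Gamma (α * m + 1) :=
  Real.Gamma_pos_of_pos (by positivity)

lemma summable_pow_div_Gamma {α : ℝ} (hα : 0 < α) {A : ℝ} (hA : 0 ≤ A) :
    Summable fun m : ℕ => A ^ m / Real.Gamma (α * m + 1) := by
  -- With this choice X^(αm) = (2A+1)^m, so the series is dominated by a geometric one of ratio
  -- A/(2A+1) < 1.
  set X : ℝ := (2 * A + 1) ^ (1 / α) with hXdef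
  have hX : 0 < X := by positivity
  have hq : A / (2 * A + 1) < 1 := by rw [div_lt_one (by positivity)]; linarith
  refine Summable.of_nonneg_of_le (fun m => div_nonneg (by positivity) (Gamma_arg_pos hα m).le)
    (fun m => ?_) ((summable_geometric_of_lt_one (by positivity) hq).mul_left (Real.exp X))
  have h := rpow_mul_exp_neg_le_Gamma (s := α * m + 1) (by
    have : 0 ≤ α * m := by positivity
    linarith) hX
  have e : X ^ (α * m + 1 - 1) = (2 * A + 1) ^ m := by
    rw [hXdef, ← Real.rpow_mul (by positivity), ← Real.rpow_natCast]
    congr 1; field_simp; ring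
  rw [e, Real.exp_neg] at h
  rw [div_le_iff₀ (Gamma_arg_pos hα m)]
  calc A ^ m = Real.exp X * (A / (2 * A + 1)) ^ m * ((2 * A + 1) ^ m * (Real.exp X)⁻¹) := by
        rw [div_pow]; field_simp
    _ ≤ _ := by gcongr

lemma summable_norm_mittagLeffler {α : ℝ} (hα : 0 < α) (w : ℂ) :
    Summable fun m : ℕ => ‖w ^ m / (Real.Gamma (α * m + 1) : ℂ)‖ := by
  refine (summable_pow_div_Gamma hα (norm_nonneg w)).congr fun m => ?_
  rw [norm_div, norm_pow, Complex.norm_real, Real.norm_of_nonneg (Gamma_arg_pos hα m).le]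

lemma mittagLeffler_one (w : ℂ) : mittagLeffler 1 w = Complex.exp w := by
  rw [mittagLeffler, Complex.exp_eq_exp_ℂ, NormedSpace.exp_eq_tsum_div]
  congr 1; ext m
  rw [one_mul, Real.Gamma_nat_eq_factorial]; simp

lemma vertical_ne_zero {c : ℝ} (hc : 0 < c) (y : ℝ) : (c : ℂ) + y * Complex.I ≠ 0 := by
  intro h
  have := congrArg Complex.re h
  simp at this; exact hc.ne' this

lemma le_norm_vertical (c y : ℝ) : c ≤ ‖(c : ℂ) + y * Complex.I‖ := by
  have := Complex.re_le_norm ((c : ℂ) + y * Complex.I)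
  simpa using this

/-- The Bromwich representation of the Mittag-Leffler function. -/
lemma integral_vertical_mittagLeffler {α c : ℝ} (hα : 0 < α) (hc : 0 < c) {w : ℂ}
    (hw : ‖w‖ < c ^ α) :
    Integrable (fun y : ℝ => Complex.exp ((c : ℂ) + y * Complex.I) * w /
      (((c : ℂ) + y * Complex.I) * (((c : ℂ) + y * Complex.I) ^ (α : ℂ) - w))) ∧
    ∫ y : ℝ, Complex.exp ((c : ℂ) + y * Complex.I) * w /
      (((c : ℂ) + y * Complex.I) * (((c : ℂ) + y * Complex.I) ^ (α : ℂ) - w)) =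
      2 * Real.pi * (mittagLeffler α w - 1) := by
  have hpos : 0 < c ^ α := by positivity
  set ζ : ℝ → ℂ := fun y => (c : ℂ) + y * Complex.I with hζ
  -- The index is shifted by one: the exponent α(m+1)+1 exceeds 1, as absolute convergence requires.
  -- The omitted term m = 0 accounts for the -1 in the formula.
  set F : ℕ → ℝ → ℂ := fun m y => w ^ (m + 1) *
    (Complex.exp (ζ y) * ζ y ^ (-((α * (m + 1 : ℕ) + 1 : ℝ) : ℂ))) with hF
  have ha : ∀ m : ℕ, 1 < α * (m + 1 : ℕ) + 1 := fun m => by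
    have : 0 < α * (m + 1 : ℕ) := by positivity
    linarith
  have hζ0 : ∀ y, ζ y ≠ 0 := vertical_ne_zero hc
  have hζc : ∀ y, c ≤ ‖ζ y‖ := le_norm_vertical c
  have hζa : ∀ y, ‖w‖ < ‖ζ y ^ (α : ℂ)‖ := fun y => by
    rw [Complex.norm_cpow_of_ne_zero (hζ0 y)]
    simp only [Complex.ofReal_re, Complex.ofReal_im, mul_zero, Real.exp_zero, div_one]
    exact hw.trans_le (Real.rpow_le_rpow hc.le (hζc y) hα.le)
  have hFeq : ∀ m y, F m y = Complex.exp (ζ y) * w / (ζ y * ζ y ^ (α : ℂ)) *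
      (w / ζ y ^ (α : ℂ)) ^ m := by
    intro m y
    have h0 : ζ y ^ (α : ℂ) ≠ 0 := by
      intro h; have := hζa y; rw [h, norm_zero] at this; exact absurd this (not_lt.2 (norm_nonneg _))
    have : ζ y ^ (-((α * (m + 1 : ℕ) + 1 : ℝ) : ℂ)) = ((ζ y ^ (α : ℂ)) ^ (m + 1) * ζ y)⁻¹ := by
      rw [Complex.cpow_neg, ← Complex.cpow_mul_nat]
      push_cast
      rw [Complex.cpow_add _ _ (hζ0 y), Complex.cpow_one]
    simp only [hF, this]
    rw [div_pow]
    field_simp [hζ0 y]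
    ring
  have hFn : ∀ m y, ‖F m y‖ ≤ Real.exp c * ‖w‖ * (‖w‖ / c ^ α) ^ m * ‖ζ y‖ ^ (-(1 + α)) := by
    intro m y
    rw [hFeq, norm_mul, norm_pow, norm_div, norm_div, norm_mul, Complex.norm_exp,
      norm_mul, Complex.norm_cpow_of_ne_zero (hζ0 y)]
    simp only [Complex.ofReal_re, Complex.ofReal_im, mul_zero, Real.exp_zero, div_one]
    have hre : (ζ y).re = c := by simp [hζ]
    have hp : 0 < ‖ζ y‖ := norm_pos_iff.2 (hζ0 y)
    rw [hre, Real.rpow_neg hp.le, Real.rpow_add hp, Real.rpow_one]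
    have : (‖w‖ / ‖ζ y‖ ^ α) ^ m ≤ (‖w‖ / c ^ α) ^ m := by
      gcongr; exact hζc y
    calc _ ≤ Real.exp c * ‖w‖ / (‖ζ y‖ * ‖ζ y‖ ^ α) * (‖w‖ / c ^ α) ^ m := by gcongr
      _ = _ := by ring
  have hFm : ∀ m, AEStronglyMeasurable (F m) := fun m => by
    have := continuous_vertical_cpow hc (-((α * (m + 1 : ℕ) + 1 : ℝ) : ℂ))
    refine Continuous.aestronglyMeasurable ?_
    simp only [hF, hζ]
    fun_prop
  have hbi : Integrable fun y => ‖ζ y‖ ^ (-(1 + α)) :=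
    integrable_vertical_norm_rpow (by linarith) hc
  have hFi : ∀ m, Integrable (F m) := fun m =>
    (hbi.const_mul (Real.exp c * ‖w‖ * (‖w‖ / c ^ α) ^ m)).mono' (hFm m)
      (Eventually.of_forall (hFn m))
  have hq : ‖w‖ / c ^ α < 1 := (div_lt_one hpos).2 hw
  have hgs : Summable fun m : ℕ => Real.exp c * ‖w‖ * (‖w‖ / c ^ α) ^ m :=
    (summable_geometric_of_lt_one (by positivity) hq).mul_left _
  have hFs : Summable fun m => ∫ y, ‖F m y‖ := by
    refine Summable.of_nonneg_of_le (fun m => integral_nonneg fun y => norm_nonneg _) (fun m => ?_)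
      (hgs.mul_right (∫ y, ‖ζ y‖ ^ (-(1 + α))))
    rw [← integral_const_mul]
    exact integral_mono (hFi m).norm (hbi.const_mul _) (hFn m)
  have hsum : ∀ y, ∑' m, F m y =
      Complex.exp (ζ y) * w / (ζ y * (ζ y ^ (α : ℂ) - w)) := by
    intro y
    have h0 : ζ y ^ (α : ℂ) ≠ 0 := by
      intro h; have := hζa y; rw [h, norm_zero] at this; exact absurd this (not_lt.2 (norm_nonneg _))
    have h1 : ζ y ^ (α : ℂ) - w ≠ 0 := by
      intro h; have := hζa y; rw [sub_eq_zero.1 h] at this; exact lt_irrefl _ this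
    have h2 : ‖w / ζ y ^ (α : ℂ)‖ < 1 := by
      rw [norm_div, div_lt_one (norm_pos_iff.2 h0)]; exact hζa y
    simp_rw [hFeq]
    rw [tsum_mul_left, tsum_geometric_of_norm_lt_one h2, one_sub_div h0]
    field_simp [hζ0 y]
  have key := hasSum_integral_of_summable_integral_norm hFi hFs
  simp_rw [hsum] at key
  have hint : ∀ m, ∫ y, F m y = 2 * Real.pi *
      (w ^ (m + 1) / (Real.Gamma (α * (m + 1 : ℕ) + 1) : ℂ)) := by
    intro m
    simp only [hF]
    rw [integral_const_mul, integral_vertical_exp_mul_cpow (ha m) hc]; ring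
  constructor
  · refine (hbi.const_mul (∑' m : ℕ, Real.exp c * ‖w‖ * (‖w‖ / c ^ α) ^ m)).mono' ?_
      (Eventually.of_forall fun y => ?_)
    · refine Continuous.aestronglyMeasurable ?_
      have := continuous_vertical_cpow hc (α : ℂ)
      refine Continuous.div (by fun_prop) (by fun_prop) fun y => mul_ne_zero (hζ0 y) ?_
      intro h; have := hζa y; rw [sub_eq_zero.1 h] at this; exact lt_irrefl _ this
    · rw [← hsum y, ← tsum_mul_right]
      exact tsum_of_norm_bounded (hgs.mul_right _).hasSum fun m => hFn m y
  · rw [← key.tsum_eq]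
    simp_rw [hint]
    rw [tsum_mul_left, mittagLeffler, (summable_norm_mittagLeffler hα w).of_norm.tsum_eq_zero_add]
    simp

/-! ### Complex powers on the slit plane and the pole-free kernel -/

lemma norm_cpow_ofReal {z : ℂ} (hz : z ≠ 0) (a : ℝ) : ‖z ^ (a : ℂ)‖ = ‖z‖ ^ a := by
  rw [Complex.norm_cpow_of_ne_zero hz]; simp

/-- Mean value inequality along the segment from 1 to y, which stays in the slit plane because that
set is star-shaped about 1. -/
lemma norm_cpow_sub_one_le {β : ℝ} (hβ : 1 ≤ β) {y : ℂ} (hy : y ∈ Complex.slitPlane) :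
    ‖y ^ (β : ℂ) - 1‖ ≤ β * max 1 ‖y‖ ^ (β - 1) * ‖y - 1‖ := by
  have hseg : segment ℝ 1 y ⊆ Complex.slitPlane :=
    Complex.starConvex_one_slitPlane.segment_subset hy
  have hb : ∀ z ∈ segment ℝ (1 : ℂ) y, ‖(β : ℂ) * z ^ ((β : ℂ) - 1)‖ ≤
      β * max 1 ‖y‖ ^ (β - 1) := by
    intro z hz
    have h0 : z ≠ 0 := Complex.slitPlane_ne_zero (hseg hz)
    have hzn : ‖z‖ ≤ max 1 ‖y‖ := by
      have := (convexOn_norm (convex_univ (𝕜 := ℝ) (E := ℂ))).le_max_of_mem_segment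
        (mem_univ 1) (mem_univ y) hz
      simpa using this
    have : (β : ℂ) - 1 = ((β - 1 : ℝ) : ℂ) := by push_cast; rfl
    rw [norm_mul, this, norm_cpow_ofReal h0, Complex.norm_real, Real.norm_of_nonneg (by linarith)]
    gcongr
  have hd : ∀ z ∈ segment ℝ (1 : ℂ) y, HasDerivWithinAt (fun z : ℂ => z ^ (β : ℂ))
      ((β : ℂ) * z ^ ((β : ℂ) - 1)) (segment ℝ (1 : ℂ) y) z := fun z hz => by
    have := (hasDerivAt_id z).cpow_const (c := (β : ℂ)) (hseg hz)
    simpa using this.hasDerivWithinAt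
  have := (convex_segment (1 : ℂ) y).norm_image_sub_le_of_norm_hasDerivWithin_le hd hb
    (left_mem_segment ℝ 1 y) (right_mem_segment ℝ 1 y)
  simpa using this

lemma abs_mul_arg_lt {α : ℝ} (hα : 0 < α) (hα1 : α ≤ 1) {u : ℂ} (hu : u ∈ Complex.slitPlane) :
    |α * u.arg| < Real.pi := by
  have h1 : |u.arg| < Real.pi :=
    lt_of_le_of_ne (Complex.abs_arg_le_pi u) fun h => by
      rcases abs_choice u.arg with h' | h'
      · exact (Complex.mem_slitPlane_iff_arg.1 hu).1 (h' ▸ h)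
      · have := Complex.neg_pi_lt_arg u
        linarith [h' ▸ h]
  rw [abs_mul, abs_of_pos hα]
  calc α * |u.arg| ≤ 1 * |u.arg| := by gcongr
    _ < _ := by simpa

lemma log_cpow_ofReal {α : ℝ} {u : ℂ} (hu : u ≠ 0) (h : |α * u.arg| < Real.pi) :
    Complex.log (u ^ (α : ℂ)) = α * Complex.log u := by
  rw [Complex.cpow_def_of_ne_zero hu, mul_comm]
  have hi : ((α : ℂ) * Complex.log u).im = α * u.arg := by simp [Complex.log_im]
  exact Complex.log_exp (by rw [hi]; exact (abs_lt.1 h).1) (by rw [hi]; exact (abs_lt.1 h).2.le)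

lemma cpow_cpow_inv {α : ℝ} (hα : 0 < α) {u : ℂ} (hu : u ≠ 0) (h : |α * u.arg| < Real.pi) :
    (u ^ (α : ℂ)) ^ ((1 / α : ℝ) : ℂ) = u := by
  have h0 : u ^ (α : ℂ) ≠ 0 := by simp [Complex.cpow_eq_zero_iff, hu]
  rw [Complex.cpow_def_of_ne_zero h0, log_cpow_ofReal hu h]
  have : (α : ℂ) ≠ 0 := by exact_mod_cast hα.ne'
  push_cast
  rw [show (α : ℂ) * Complex.log u * (1 / α) = Complex.log u by field_simp, Complex.exp_log hu]

lemma cpow_mem_slitPlane {α : ℝ} {u : ℂ} (hu : u ≠ 0) (h : |α * u.arg| < Real.pi) :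
    u ^ (α : ℂ) ∈ Complex.slitPlane := by
  refine Complex.mem_slitPlane_iff_arg.2 ⟨?_, by simp [Complex.cpow_eq_zero_iff, hu]⟩
  have := congrArg Complex.im (log_cpow_ofReal hu h)
  rw [Complex.log_im] at this
  rw [this]
  simp only [Complex.mul_im, Complex.ofReal_re, Complex.ofReal_im, Complex.log_im, zero_mul,
    add_zero]
  exact ((abs_lt.1 h).2).ne

/-- A lower bound for `u ^ α - 1` on the slit plane, from the mean value inequality for
`y ^ (1 / α)`. -/
lemma norm_sub_one_le_cpow {α : ℝ} (hα : 0 < α) (hα1 : α ≤ 1) {u : ℂ}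
    (hu : u ∈ Complex.slitPlane) :
    α * ‖u - 1‖ ≤ max 1 ‖u‖ ^ (1 - α) * ‖u ^ (α : ℂ) - 1‖ := by
  have hu0 := Complex.slitPlane_ne_zero hu
  have harg := abs_mul_arg_lt hα hα1 hu
  have h := norm_cpow_sub_one_le (β := 1 / α) (by rw [le_div_iff₀ hα]; linarith)
    (cpow_mem_slitPlane hu0 harg)
  rw [cpow_cpow_inv hα hu0 harg, norm_cpow_ofReal hu0] at h
  have hM : max 1 (‖u‖ ^ α) ≤ max 1 ‖u‖ ^ α := by
    refine max_le (Real.one_le_rpow (le_max_left _ _) hα.le) ?_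
    exact Real.rpow_le_rpow (norm_nonneg _) (le_max_right _ _) hα.le
  have h2 : max 1 (‖u‖ ^ α) ^ (1 / α - 1) ≤ max 1 ‖u‖ ^ (1 - α) := by
    calc _ ≤ (max 1 ‖u‖ ^ α) ^ (1 / α - 1) := by
          refine Real.rpow_le_rpow (by positivity) hM ?_
          rw [sub_nonneg, le_div_iff₀ hα]; linarith
      _ = _ := by
          rw [← Real.rpow_mul (by positivity)]
          congr 1; field_simp
  calc α * ‖u - 1‖ ≤ α * (1 / α * max 1 (‖u‖ ^ α) ^ (1 / α - 1) * ‖u ^ (α : ℂ) - 1‖) := by gcongr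
    _ = max 1 (‖u‖ ^ α) ^ (1 / α - 1) * ‖u ^ (α : ℂ) - 1‖ := by field_simp
    _ ≤ _ := by gcongr

/-- The holomorphic extension to the slit plane of `u ↦ 1 / (u ^ α - 1) - 1 / (α (u - 1))`. -/
def powKernel (α : ℝ) : ℂ → ℂ :=
  dslope (fun u => (dslope (fun z : ℂ => z ^ (α : ℂ)) 1 u)⁻¹) 1

lemma hasDerivAt_cpow_one (α : ℝ) : HasDerivAt (fun z : ℂ => z ^ (α : ℂ)) α 1 := by
  have := (hasDerivAt_id (1 : ℂ)).cpow_const (c := (α : ℂ)) Complex.one_mem_slitPlane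
  simpa using this

/-- By `norm_sub_one_le_cpow`, u^α = 1 only at u = 1, and there the derivative is α. So the quotient
(u - 1)/(u^α - 1) is holomorphic on the whole slit plane. -/
lemma dslope_cpow_one_ne_zero {α : ℝ} (hα : 0 < α) (hα1 : α ≤ 1) {u : ℂ}
    (hu : u ∈ Complex.slitPlane) : dslope (fun z : ℂ => z ^ (α : ℂ)) 1 u ≠ 0 := by
  rcases eq_or_ne u 1 with rfl | h1
  · rw [dslope_same, (hasDerivAt_cpow_one α).deriv]; exact_mod_cast hα.ne'
  · rw [dslope_of_ne _ h1, slope_def_field]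
    have h := norm_sub_one_le_cpow hα hα1 hu
    have hp : 0 < α * ‖u - 1‖ := mul_pos hα (norm_pos_iff.2 (sub_ne_zero.2 h1))
    refine div_ne_zero (fun h0 => ?_) (sub_ne_zero.2 h1)
    rw [Complex.one_cpow] at h0
    rw [h0, norm_zero, mul_zero] at h
    linarith

/-- The inner reciprocal slope is (u - 1)/(u^α - 1), with value 1/α at u = 1; its slope at 1 is the
stated difference. -/
lemma powKernel_of_ne {α : ℝ} {u : ℂ} (h1 : u ≠ 1) :
    powKernel α u = 1 / (u ^ (α : ℂ) - 1) - 1 / (α * (u - 1)) := by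
  rw [powKernel, dslope_of_ne _ h1, slope_def_field, dslope_same, (hasDerivAt_cpow_one α).deriv,
    dslope_of_ne _ h1, slope_def_field, Complex.one_cpow]
  have := sub_ne_zero.2 h1
  rw [inv_div, sub_div, div_div, mul_comm _ (u - 1), ← div_div, div_self this]
  rw [← one_div, div_div]

lemma differentiableOn_powKernel {α : ℝ} (hα : 0 < α) (hα1 : α ≤ 1) :
    DifferentiableOn ℂ (powKernel α) Complex.slitPlane := by
  have hn : Complex.slitPlane ∈ 𝓝 (1 : ℂ) :=
    Complex.isOpen_slitPlane.mem_nhds Complex.one_mem_slitPlane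
  refine (Complex.differentiableOn_dslope hn).2 (DifferentiableOn.inv
    ((Complex.differentiableOn_dslope hn).2 fun u hu => ?_)
    fun u hu => dslope_cpow_one_ne_zero hα hα1 hu)
  exact (differentiableAt_id.cpow_const hu).differentiableWithinAt

/-- Near 1 the bound is compactness; away from 1 each of the two fractions is bounded separately.
The decay |u|^(-α), together with the factor 1/z of the contour integrand, makes the latter
absolutely integrable on vertical lines. -/
lemma exists_norm_powKernel_le {α : ℝ} (hα : 0 < α) (hα1 : α ≤ 1) :
    ∃ C > 0, ∀ u ∈ Complex.slitPlane, ‖powKernel α u‖ ≤ C * ‖u‖ ^ (-α) := by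
  have hsub : Metric.closedBall (1 : ℂ) (1 / 2) ⊆ Complex.slitPlane := by
    intro u hu
    left
    rw [Metric.mem_closedBall, dist_eq_norm] at hu
    have := (Complex.abs_re_le_norm (u - 1)).trans hu
    rw [Complex.sub_re, Complex.one_re, abs_le] at this
    linarith
  obtain ⟨C₀, hC₀⟩ := (isCompact_closedBall (1 : ℂ) (1 / 2)).exists_bound_of_continuousOn
    ((differentiableOn_powKernel hα hα1).continuousOn.mono hsub)
  refine ⟨max (2 * C₀) (8 / α), by positivity, fun u hu => ?_⟩
  have hu0 := Complex.slitPlane_ne_zero hu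
  have hup : 0 < ‖u‖ := norm_pos_iff.2 hu0
  by_cases hball : u ∈ Metric.closedBall (1 : ℂ) (1 / 2)
  · have h1 := hC₀ u hball
    have hC₀0 : 0 ≤ C₀ := (norm_nonneg _).trans h1
    have h2 : ‖u‖ ≤ 2 := by
      rw [Metric.mem_closedBall, dist_eq_norm] at hball
      have := norm_le_norm_add_norm_sub' u 1
      rw [norm_one] at this; linarith
    have h3 : 1 / 2 ≤ ‖u‖ ^ (-α) := by
      rw [Real.rpow_neg hup.le, one_div]
      gcongr
      calc ‖u‖ ^ α ≤ 2 ^ α := by gcongr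
        _ ≤ 2 ^ (1 : ℝ) := Real.rpow_le_rpow_of_exponent_le (by norm_num) hα1
        _ = 2 := by norm_num
    calc _ ≤ C₀ := h1
      _ = 2 * C₀ * (1 / 2) := by ring
      _ ≤ _ := by gcongr; exact le_max_left _ _
  · have hd : 1 / 2 < ‖u - 1‖ := by
      rw [Metric.mem_closedBall, dist_eq_norm] at hball; exact not_le.1 hball
    have h1 : u ≠ 1 := by rintro rfl; norm_num at hd
    set M := max 1 ‖u‖ with hM
    have hM1 : 1 ≤ M := le_max_left _ _
    -- Outside the ball |u - 1| > 1/2, hence |u| ≤ 1 + |u - 1| < 3|u - 1|.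
    have hdM : M / 4 ≤ ‖u - 1‖ := by
      have := norm_le_norm_add_norm_sub' u 1
      rw [norm_one] at this
      rcases max_choice 1 ‖u‖ with h | h <;> rw [hM, h] <;> linarith
    have hlow := norm_sub_one_le_cpow hα hα1 hu
    have hMp : 0 < M ^ (1 - α) := by positivity
    have hd0 : 0 < ‖u - 1‖ := by linarith
    have hpow0 : 0 < ‖u ^ (α : ℂ) - 1‖ := by
      by_contra h
      have h' : ‖u ^ (α : ℂ) - 1‖ = 0 := le_antisymm (not_lt.1 h) (norm_nonneg _)
      rw [h', mul_zero] at hlow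
      have := mul_pos hα hd0
      linarith
    rw [powKernel_of_ne h1]
    calc ‖1 / (u ^ (α : ℂ) - 1) - 1 / (α * (u - 1))‖
        ≤ 1 / ‖u ^ (α : ℂ) - 1‖ + 1 / (α * ‖u - 1‖) := by
          refine (norm_sub_le _ _).trans_eq ?_
          rw [norm_div, norm_div, norm_mul, norm_one, Complex.norm_real,
            Real.norm_of_nonneg hα.le]
      _ ≤ M ^ (1 - α) / (α * ‖u - 1‖) + M ^ (1 - α) / (α * ‖u - 1‖) := by
          refine add_le_add ?_ (div_le_div_of_nonneg_right
            (Real.one_le_rpow hM1 (by linarith)) (by positivity))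
          rw [div_le_div_iff₀ hpow0 (by positivity)]; linarith
      _ = 2 * M ^ (1 - α) / (α * ‖u - 1‖) := by ring
      _ ≤ 2 * M ^ (1 - α) / (α * (M / 4)) := by gcongr
      _ = 8 / α * M ^ (-α) := by
          rw [Real.rpow_sub (by positivity), Real.rpow_one, Real.rpow_neg (by positivity)]
          field_simp; ring
      _ ≤ max (2 * C₀) (8 / α) * ‖u‖ ^ (-α) := by
          refine mul_le_mul (le_max_right _ _) ?_ (by positivity) (by positivity)
          exact Real.rpow_le_rpow_of_nonpos hup (le_max_right _ _) (by linarith)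

/-! ### Contour shift and exponential asymptotics of the Mittag-Leffler function -/

/-- Shifting a vertical contour inside the right half-plane. -/
lemma integral_vertical_eq {H : ℂ → ℂ} (hH : DifferentiableOn ℂ H {z | 0 < z.re}) {c₀ c K s : ℝ}
    (hc₀ : 0 < c₀) (hc : c₀ ≤ c) (hs : 1 < s)
    (hb : ∀ z : ℂ, c₀ ≤ z.re → z.re ≤ c → ‖H z‖ ≤ K * ‖z‖ ^ (-s)) :
    ∫ y : ℝ, H ((c₀ : ℂ) + y * Complex.I) = ∫ y : ℝ, H ((c : ℂ) + y * Complex.I) := by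
  have hcont : ∀ b : ℝ, 0 < b → Continuous fun y : ℝ => H ((b : ℂ) + y * Complex.I) := by
    intro b hb'
    exact hH.continuousOn.comp_continuous (by fun_prop) fun y => by simpa using hb'
  have hint : ∀ b : ℝ, c₀ ≤ b → b ≤ c →
      Integrable fun y : ℝ => H ((b : ℂ) + y * Complex.I) := by
    intro b h1 h2
    refine ((integrable_vertical_norm_rpow hs (hc₀.trans_le h1)).const_mul K).mono'
      (hcont b (hc₀.trans_le h1)).aestronglyMeasurable (Eventually.of_forall fun y => ?_)
    exact hb _ (by simpa using h1) (by simpa using h2)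
  have hlim : ∀ b : ℝ, c₀ ≤ b → b ≤ c → Tendsto (fun N : ℝ => ∫ y in (-N)..N,
      H ((b : ℂ) + y * Complex.I)) atTop (𝓝 (∫ y : ℝ, H ((b : ℂ) + y * Complex.I))) :=
    fun b h1 h2 => intervalIntegral_tendsto_integral (hint b h1 h2)
      tendsto_neg_atTop_atBot tendsto_id
  have hK : 0 ≤ K := by
    have h := (norm_nonneg _).trans (hb c₀ (by simp) (by simpa))
    have : 0 < ‖(c₀ : ℂ)‖ ^ (-s) := Real.rpow_pos_of_pos (by simp [hc₀.ne']) _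
    exact nonneg_of_mul_nonneg_left h this
  have hN : Tendsto (fun N : ℝ => K * N ^ (-s) * |c - c₀|) atTop (𝓝 0) := by
    have := ((tendsto_rpow_neg_atTop (show 0 < s by linarith)).const_mul K).mul_const |c - c₀|
    simpa using this
  have hhor : ∀ σ : ℝ, |σ| = 1 → Tendsto (fun N : ℝ => ∫ x in c₀..c,
      H ((x : ℂ) + ((σ * N : ℝ) : ℂ) * Complex.I)) atTop (𝓝 0) := by
    intro σ hσ
    refine squeeze_zero_norm' ?_ hN
    filter_upwards [eventually_gt_atTop 0] with N hN0
    refine intervalIntegral.norm_integral_le_of_norm_le_const fun x hx => ?_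
    rw [uIoc_of_le hc] at hx
    refine (hb _ (by simpa using hx.1.le) (by simpa using hx.2)).trans ?_
    refine mul_le_mul_of_nonneg_left (Real.rpow_le_rpow_of_nonpos hN0 ?_ (by linarith)) hK
    have := Complex.abs_im_le_norm ((x : ℂ) + ((σ * N : ℝ) : ℂ) * Complex.I)
    simpa [abs_mul, hσ, abs_of_pos hN0] using this
  -- Cauchy's theorem on the rectangle of height 2N; the horizontal sides are O(N^(-s)) and vanish
  -- in the limit.
  have hrect : ∀ N : ℝ, (∫ x in c₀..c, H ((x : ℂ) + (((-1) * N : ℝ) : ℂ) * Complex.I)) -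
      (∫ x in c₀..c, H ((x : ℂ) + ((1 * N : ℝ) : ℂ) * Complex.I)) +
      Complex.I • (∫ y in (-N)..N, H ((c : ℂ) + y * Complex.I)) -
      Complex.I • (∫ y in (-N)..N, H ((c₀ : ℂ) + y * Complex.I)) = 0 := by
    intro N
    have := Complex.integral_boundary_rect_eq_zero_of_differentiableOn H
      ((c₀ : ℂ) + ((-N : ℝ) : ℂ) * Complex.I) ((c : ℂ) + (N : ℂ) * Complex.I)
      (hH.mono fun z hz => ?_)
    · simpa using this
    · have h1 := (Complex.mem_reProdIm.1 hz).1
      simp only [Complex.add_re, Complex.ofReal_re, Complex.mul_re, Complex.I_re, mul_zero,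
        Complex.ofReal_im, Complex.I_im, mul_one, sub_self, add_zero, uIcc_of_le hc] at h1
      exact hc₀.trans_le h1.1
  have htot := ((((hhor (-1) (by simp)).sub (hhor 1 (by simp))).add
    ((hlim c hc le_rfl).const_smul Complex.I)).sub ((hlim c₀ le_rfl hc).const_smul Complex.I))
  simp_rw [hrect] at htot
  have h0 := tendsto_nhds_unique tendsto_const_nhds htot
  simp only [sub_self, zero_add, smul_eq_mul] at h0
  have := sub_eq_zero.1 h0.symm
  exact (mul_left_cancel₀ Complex.I_ne_zero this).symm

lemma abs_arg_sub_lt {z v : ℂ} (hz : 0 < z.re) (hv : 0 < v.re) : |z.arg - v.arg| < Real.pi := by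
  have h1 := abs_lt.1 (Complex.abs_arg_lt_pi_div_two_iff.2 (Or.inl hz))
  have h2 := abs_lt.1 (Complex.abs_arg_lt_pi_div_two_iff.2 (Or.inl hv))
  rw [abs_lt]; constructor <;> linarith [h1.1, h1.2, h2.1, h2.2]

lemma log_div_of_re_pos {z v : ℂ} (hz : 0 < z.re) (hv : 0 < v.re) :
    Complex.log (z / v) = Complex.log z - Complex.log v := by
  have hz0 : z ≠ 0 := by rintro rfl; simp at hz
  have hv0 : v ≠ 0 := by rintro rfl; simp at hv
  have h := abs_lt.1 (abs_arg_sub_lt hz hv)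
  rw [← Complex.log_exp (x := Complex.log z - Complex.log v)
    (by simpa [Complex.log_im] using h.1)
    (by simpa [Complex.log_im] using h.2.le),
    Complex.exp_sub, Complex.exp_log hz0, Complex.exp_log hv0]

lemma div_mem_slitPlane {z v : ℂ} (hz : 0 < z.re) (hv : 0 < v.re) :
    z / v ∈ Complex.slitPlane := by
  have hz0 : z ≠ 0 := by rintro rfl; simp at hz
  have hv0 : v ≠ 0 := by rintro rfl; simp at hv
  refine Complex.mem_slitPlane_iff_arg.2 ⟨?_, div_ne_zero hz0 hv0⟩
  rw [← Complex.log_im, log_div_of_re_pos hz hv]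
  simpa [Complex.log_im] using (abs_lt.1 (abs_arg_sub_lt hz hv)).2.ne

lemma div_cpow_of_re_pos {z v : ℂ} (hz : 0 < z.re) (hv : 0 < v.re) (s : ℂ) :
    (z / v) ^ s = z ^ s / v ^ s := by
  have hz0 : z ≠ 0 := by rintro rfl; simp at hz
  have hv0 : v ≠ 0 := by rintro rfl; simp at hv
  rw [Complex.cpow_def_of_ne_zero (div_ne_zero hz0 hv0), log_div_of_re_pos hz hv, sub_mul,
    Complex.exp_sub, ← Complex.cpow_def_of_ne_zero hz0, ← Complex.cpow_def_of_ne_zero hv0]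

/-- The exponential asymptotics of `E_α(v ^ α)` on the right half-plane. -/
lemma exists_norm_mittagLeffler_sub_exp_le {α : ℝ} (hα : 0 < α) (hα1 : α ≤ 1) :
    ∃ C > 0, ∀ v : ℂ, 0 < v.re →
      ‖mittagLeffler α (v ^ (α : ℂ)) - Complex.exp v / α‖ ≤ C * (1 + ‖v‖) := by
  obtain ⟨C, hC, hB⟩ := exists_norm_powKernel_le hα hα1
  set J := ∫ y : ℝ, ‖((1 : ℝ) : ℂ) + y * Complex.I‖ ^ (-(1 + α)) with hJ
  have hJi := integrable_vertical_norm_rpow (a := 1 + α) (by linarith) one_pos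
  have hJ0 : 0 ≤ J := integral_nonneg fun y => by positivity
  refine ⟨1 + 1 / α + Real.exp 1 * C * J, by positivity, fun v hv => ?_⟩
  have hv0 : v ≠ 0 := by rintro rfl; simp at hv
  have hvn : 0 < ‖v‖ := norm_pos_iff.2 hv0
  set H : ℂ → ℂ := fun z => Complex.exp z / z * powKernel α (z / v) with hHdef
  have hHd : DifferentiableOn ℂ H {z | 0 < z.re} := by
    intro z hz
    have hz' : 0 < z.re := hz
    have hz0 : z ≠ 0 := by rintro rfl; simp at hz'
    have h1 : DifferentiableAt ℂ (powKernel α) (z / v) :=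
      (differentiableOn_powKernel hα hα1).differentiableAt
        (Complex.isOpen_slitPlane.mem_nhds (div_mem_slitPlane hz hv))
    have h2 : DifferentiableAt ℂ (fun z => powKernel α (z / v)) z :=
      DifferentiableAt.comp (f := fun z => z / v) z h1 (by fun_prop)
    exact ((Complex.differentiableAt_exp.div differentiableAt_id hz0).mul
      h2).differentiableWithinAt
  have hHb : ∀ b : ℝ, ∀ z : ℂ, 0 < z.re → z.re ≤ b →
      ‖H z‖ ≤ Real.exp b * C * ‖v‖ ^ α * ‖z‖ ^ (-(1 + α)) := by
    intro b z hz hzb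
    have hz0 : z ≠ 0 := by rintro rfl; simp at hz
    have hzn : 0 < ‖z‖ := norm_pos_iff.2 hz0
    have h1 := hB _ (div_mem_slitPlane hz hv)
    rw [norm_div, Real.div_rpow hzn.le hvn.le, Real.rpow_neg hvn.le, div_inv_eq_mul] at h1
    simp only [hHdef]
    rw [norm_mul, norm_div, Complex.norm_exp, neg_add, Real.rpow_add hzn, Real.rpow_neg_one]
    calc _ ≤ Real.exp b / ‖z‖ * (C * (‖z‖ ^ (-α) * ‖v‖ ^ α)) := by gcongr
      _ = _ := by ring
  -- A line far enough to the right for both representations, the one of order α at v^α and the one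
  -- of order 1 at v.
  set c : ℝ := ‖v‖ + 1 with hc
  have hc0 : 0 < c := by positivity
  have hw : ‖v ^ (α : ℂ)‖ < c ^ α := by
    rw [norm_cpow_ofReal hv0]
    exact Real.rpow_lt_rpow hvn.le (by linarith) hα
  have hv1 : ‖v‖ < c ^ (1 : ℝ) := by rw [Real.rpow_one]; linarith
  obtain ⟨i1, e1⟩ := integral_vertical_mittagLeffler hα hc0 hw
  obtain ⟨i2, e2⟩ := integral_vertical_mittagLeffler one_pos hc0 hv1
  have hαc : (α : ℂ) ≠ 0 := by exact_mod_cast hα.ne'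
  have hpt : ∀ y : ℝ, H ((c : ℂ) + y * Complex.I) =
      Complex.exp ((c : ℂ) + y * Complex.I) * v ^ (α : ℂ) / (((c : ℂ) + y * Complex.I) *
        (((c : ℂ) + y * Complex.I) ^ (α : ℂ) - v ^ (α : ℂ))) -
      (1 / α : ℂ) * (Complex.exp ((c : ℂ) + y * Complex.I) * v / (((c : ℂ) + y * Complex.I) *
        (((c : ℂ) + y * Complex.I) ^ ((1 : ℝ) : ℂ) - v))) := by
    intro y
    set z := (c : ℂ) + y * Complex.I with hz
    have hzre : 0 < z.re := by simpa [hz] using hc0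
    have hz0 : z ≠ 0 := vertical_ne_zero hc0 y
    have hzv : z - v ≠ 0 := by
      intro h
      have h1 := congrArg Complex.re (sub_eq_zero.1 h)
      have h2 := Complex.re_le_norm v
      simp [hz] at h1
      linarith
    have hva : v ^ (α : ℂ) ≠ 0 := by simp [Complex.cpow_eq_zero_iff, hv0]
    have hza : z ^ (α : ℂ) - v ^ (α : ℂ) ≠ 0 := by
      intro h
      have h1 := congrArg norm (sub_eq_zero.1 h)
      rw [norm_cpow_ofReal hz0] at h1
      have h2 : c ^ α ≤ ‖z‖ ^ α := Real.rpow_le_rpow hc0.le (le_norm_vertical c y) hα.le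
      linarith
    have hne : z / v ≠ 1 := by
      intro h; rw [div_eq_one_iff_eq hv0] at h; exact hzv (sub_eq_zero.2 h)
    simp only [hHdef]
    rw [powKernel_of_ne hne, div_cpow_of_re_pos hzre hv, div_sub_one hva, div_sub_one hv0]
    simp only [Complex.ofReal_one, Complex.cpow_one]
    field_simp
  have hE : ∫ y : ℝ, H ((c : ℂ) + y * Complex.I) =
      2 * Real.pi * (mittagLeffler α (v ^ (α : ℂ)) - 1) -
        (1 / α : ℂ) * (2 * Real.pi * (Complex.exp v - 1)) := by
    simp_rw [hpt]
    rw [integral_sub i1 (i2.const_mul _), integral_const_mul, e1, e2, mittagLeffler_one]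
  -- The constant e^c only justifies the shift. On the new line Re z = 1 the exponential is at most
  -- e, whatever v is.
  rw [← integral_vertical_eq hHd one_pos (show (1 : ℝ) ≤ c by linarith)
    (show 1 < 1 + α by linarith)
    (fun z h1 h2 => hHb c z (by linarith) h2)] at hE
  have hI : ‖∫ y : ℝ, H (((1 : ℝ) : ℂ) + y * Complex.I)‖ ≤ Real.exp 1 * C * ‖v‖ ^ α * J := by
    rw [hJ, ← integral_const_mul]
    refine norm_integral_le_of_norm_le (hJi.const_mul _) (Eventually.of_forall fun y => ?_)
    exact hHb 1 _ (by simp) (by simp)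
  have hpi : (Real.pi : ℂ) ≠ 0 := by exact_mod_cast Real.pi_ne_zero
  have hfin : mittagLeffler α (v ^ (α : ℂ)) - Complex.exp v / α =
      (1 - 1 / α) + (∫ y : ℝ, H (((1 : ℝ) : ℂ) + y * Complex.I)) / (2 * Real.pi) := by
    rw [hE]; field_simp; ring
  have hvα : ‖v‖ ^ α ≤ 1 + ‖v‖ := by
    rcases le_total ‖v‖ 1 with h | h
    · have := Real.rpow_le_one hvn.le h hα.le
      linarith
    · have := Real.rpow_le_rpow_of_exponent_le h hα1
      rw [Real.rpow_one] at this; linarith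
  have hn : ‖(2 * Real.pi : ℂ)‖ = 2 * Real.pi := by
    rw [norm_mul, Complex.norm_real, Real.norm_of_nonneg Real.pi_pos.le]; simp
  have h1 : ‖(1 - 1 / α : ℂ)‖ ≤ 1 + 1 / α := by
    refine (norm_sub_le _ _).trans_eq ?_
    rw [norm_div, norm_one, Complex.norm_real, Real.norm_of_nonneg hα.le]
  rw [hfin]
  calc _ ≤ (1 + 1 / α) + Real.exp 1 * C * ‖v‖ ^ α * J / (2 * Real.pi) := by
        refine (norm_add_le _ _).trans (add_le_add h1 ?_)
        rw [norm_div, hn]; gcongr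
    _ ≤ (1 + 1 / α) + Real.exp 1 * C * ‖v‖ ^ α * J := by
        gcongr
        exact div_le_self (by positivity) (by linarith [Real.pi_gt_three])
    _ ≤ (1 + 1 / α) * (1 + ‖v‖) + Real.exp 1 * C * (1 + ‖v‖) * J := by
        gcongr
        exact le_mul_of_one_le_right (by positivity) (by linarith)
    _ = _ := by ring

/-! ### Bessel factors as moments on [0, 1] -/

/-- The normalized Bessel function `m! (2/t)^m J_m(t)` as an entire function of `q = (t/2)^2`. -/
def besselSeries (m : ℕ) (q : ℂ) : ℂ :=
  ∑' n : ℕ, (-q) ^ n * ((m ! : ℂ) / ((m + n)! * n !))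

/-- The kernel expressing `besselSeries m q - 1` as the `m`-th moment of a function on `[0, 1]`. -/
def besselKernel (q : ℂ) (s : ℝ) : ℂ :=
  ∑' n : ℕ, (-q) ^ (n + 1) / ((n + 1)! * n !) * (1 - s : ℂ) ^ n

/-- The modified Mittag-Leffler function, in independent complex variables
`w = τ (x₁ + i x₂)` and `q = (k |x| / 2)^2`. -/
def twoVarML (α : ℝ) (w q : ℂ) : ℂ :=
  ∑' m : ℕ, w ^ m / (Real.Gamma (α * m + 1) : ℂ) * besselSeries m q

lemma integral_pow_mul_one_sub_pow (m n : ℕ) :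
    ∫ s in (0 : ℝ)..1, (s : ℂ) ^ m * (1 - s : ℂ) ^ n = (m ! : ℂ) * n ! / (m + n + 1)! := by
  have h := Complex.betaIntegral_eq_Gamma_mul_div (m + 1) (n + 1)
    (by simp; positivity) (by simp; positivity)
  rw [Complex.betaIntegral] at h
  simp only [add_sub_cancel_right, Complex.cpow_natCast, Complex.Gamma_nat_eq_factorial] at h
  rw [h]
  congr 1
  rw [← Complex.Gamma_nat_eq_factorial]
  push_cast; ring_nf

lemma summable_mul_pow_div_factorial (Q : ℝ) : Summable fun n : ℕ => Q * (Q ^ n / n !) :=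
  (Real.summable_pow_div_factorial Q).mul_left Q

lemma norm_besselKernel_term_le {Q : ℝ} {q : ℂ} (hq : ‖q‖ ≤ Q) (n : ℕ) {s : ℝ}
    (hs : s ∈ Icc (0 : ℝ) 1) :
    ‖(-q) ^ (n + 1) / ((n + 1)! * n !) * (1 - s : ℂ) ^ n‖ ≤ Q * (Q ^ n / n !) := by
  have h1 : ‖(1 - s : ℂ)‖ ≤ 1 := by
    rw [← Complex.ofReal_one, ← Complex.ofReal_sub, Complex.norm_real, Real.norm_of_nonneg
      (by linarith [hs.2])]
    linarith [hs.1]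
  have h2 : (1 : ℝ) ≤ (n + 1)! := by exact_mod_cast Nat.factorial_pos _
  have h3 : (0 : ℝ) < n ! := by exact_mod_cast Nat.factorial_pos _
  have hQ : 0 ≤ Q := (norm_nonneg q).trans hq
  rw [norm_mul, norm_div, norm_pow, norm_neg, norm_mul, norm_pow, Complex.norm_natCast,
    Complex.norm_natCast]
  calc ‖q‖ ^ (n + 1) / ((n + 1)! * n !) * ‖(1 - s : ℂ)‖ ^ n
      ≤ Q ^ (n + 1) / (1 * n !) * 1 ^ n := by gcongr
    _ = _ := by rw [pow_succ, one_pow]; field_simp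

lemma continuousOn_besselKernel (q : ℂ) : ContinuousOn (besselKernel q) (Icc 0 1) :=
  continuousOn_tsum (fun n => by fun_prop) (summable_mul_pow_div_factorial ‖q‖)
    fun n _ hs => norm_besselKernel_term_le le_rfl n hs

lemma norm_besselKernel_le {Q : ℝ} {q : ℂ} (hq : ‖q‖ ≤ Q) {s : ℝ} (hs : s ∈ Icc (0 : ℝ) 1) :
    ‖besselKernel q s‖ ≤ ∑' n : ℕ, Q * (Q ^ n / n !) :=
  tsum_of_norm_bounded (summable_mul_pow_div_factorial Q).hasSum
    fun n => norm_besselKernel_term_le hq n hs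

lemma norm_ofReal_pow_le_one {s : ℝ} (hs : s ∈ Icc (0 : ℝ) 1) (m : ℕ) : ‖(s : ℂ) ^ m‖ ≤ 1 := by
  rw [norm_pow, Complex.norm_real, Real.norm_of_nonneg hs.1]
  exact pow_le_one₀ hs.1 hs.2

lemma norm_besselSeries_term_le (m n : ℕ) {Q : ℝ} {q : ℂ} (hq : ‖q‖ ≤ Q) :
    ‖(-q) ^ n * ((m ! : ℂ) / ((m + n)! * n !))‖ ≤ Q ^ n / n ! := by
  have h1 : (m ! : ℝ) ≤ (m + n)! := by exact_mod_cast Nat.factorial_le (by omega)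
  have h2 : (0 : ℝ) < (m + n)! := by exact_mod_cast Nat.factorial_pos _
  have h3 : (0 : ℝ) < n ! := by exact_mod_cast Nat.factorial_pos _
  have hQ : 0 ≤ Q := (norm_nonneg q).trans hq
  rw [norm_mul, norm_pow, norm_neg, norm_div, norm_mul, Complex.norm_natCast,
    Complex.norm_natCast, Complex.norm_natCast]
  calc ‖q‖ ^ n * ((m ! : ℝ) / ((m + n)! * n !)) ≤ Q ^ n * ((m + n)! / ((m + n)! * n !)) := by
        gcongr
    _ = _ := by field_simp

lemma norm_besselSeries_le (m : ℕ) {Q : ℝ} {q : ℂ} (hq : ‖q‖ ≤ Q) :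
    ‖besselSeries m q‖ ≤ Real.exp Q := by
  have := NormedSpace.expSeries_div_hasSum_exp Q
  rw [← Real.exp_eq_exp_ℝ] at this
  exact tsum_of_norm_bounded this fun n => norm_besselSeries_term_le m n hq

lemma differentiable_besselSeries (m : ℕ) : Differentiable ℂ (besselSeries m) := by
  intro q
  have h := Complex.differentiableOn_tsum_of_summable_norm
    (F := fun n q => (-q) ^ n * ((m ! : ℂ) / ((m + n)! * n !)))
    (Real.summable_pow_div_factorial (‖q‖ + 1)) (fun n => by fun_prop)
    (Metric.isOpen_ball (x := (0 : ℂ)) (ε := ‖q‖ + 1))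
    fun n z hz => norm_besselSeries_term_le m n (by simpa using (mem_ball_zero_iff.1 hz).le)
  exact h.differentiableAt (Metric.isOpen_ball.mem_nhds (by simp))

lemma norm_deriv_besselSeries_le (m : ℕ) {Q : ℝ} {q : ℂ} (hq : ‖q‖ ≤ Q) :
    ‖deriv (besselSeries m) q‖ ≤ Real.exp (Q + 1) := by
  have := Complex.norm_deriv_le_of_forall_mem_sphere_norm_le one_pos
    (differentiable_besselSeries m).diffContOnCl (c := q) (C := Real.exp (Q + 1)) fun z hz => by
      refine norm_besselSeries_le m ?_
      have h1 := norm_le_norm_add_norm_sub' z q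
      rw [mem_sphere_iff_norm.1 hz] at h1
      linarith
  simpa using this

/-- The term n = 0 of the series is 1. In the term n + 1 the quotient m! n!/(m+n+1)! is the beta
integral of s^m (1-s)^n, and summation under the integral produces the kernel. -/
lemma besselSeries_eq_integral (m : ℕ) (q : ℂ) :
    besselSeries m q = 1 + ∫ s in Ioc (0 : ℝ) 1, (s : ℂ) ^ m * besselKernel q s := by
  set F : ℕ → ℝ → ℂ := fun n s =>
    (-q) ^ (n + 1) / ((n + 1)! * n !) * ((s : ℂ) ^ m * (1 - s : ℂ) ^ n) with hF
  have hFb : ∀ n, ∀ s ∈ Ioc (0 : ℝ) 1, ‖F n s‖ ≤ ‖q‖ * (‖q‖ ^ n / n !) := by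
    intro n s hs
    have hs' := Ioc_subset_Icc_self hs
    have e : F n s = (-q) ^ (n + 1) / ((n + 1)! * n !) * (1 - s : ℂ) ^ n * (s : ℂ) ^ m := by
      simp only [hF]; ring
    rw [e, norm_mul]
    calc _ ≤ ‖q‖ * (‖q‖ ^ n / n !) * 1 := by
          gcongr
          · exact norm_besselKernel_term_le le_rfl n hs'
          · exact norm_ofReal_pow_le_one hs' m
      _ = _ := mul_one _
  have hFi : ∀ n, Integrable (F n) (volume.restrict (Ioc (0 : ℝ) 1)) := fun n => by
    have : Continuous (F n) := by simp only [hF]; fun_prop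
    exact (this.integrableOn_Icc (a := 0) (b := 1)).mono_set Ioc_subset_Icc_self
  have hFs : Summable fun n => ∫ s in Ioc (0 : ℝ) 1, ‖F n s‖ := by
    refine Summable.of_nonneg_of_le (fun n => integral_nonneg fun _ => norm_nonneg _) (fun n => ?_)
      (summable_mul_pow_div_factorial ‖q‖)
    have := setIntegral_mono_on (hFi n).norm (integrable_const (‖q‖ * (‖q‖ ^ n / n !)))
      measurableSet_Ioc (hFb n)
    simpa using this
  have key := (hasSum_integral_of_summable_integral_norm hFi hFs).tsum_eq
  have e1 : ∀ n, ∫ s in Ioc (0 : ℝ) 1, F n s =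
      (-q) ^ (n + 1) * ((m ! : ℂ) / ((m + (n + 1))! * (n + 1)!)) := by
    intro n
    simp only [hF]
    rw [integral_const_mul, ← intervalIntegral.integral_of_le zero_le_one,
      integral_pow_mul_one_sub_pow]
    have h3 : (n ! : ℂ) ≠ 0 := by exact_mod_cast (Nat.factorial_pos _).ne'
    rw [← add_assoc]
    field_simp
  have e2 : ∀ s : ℝ, ∑' n, F n s = (s : ℂ) ^ m * besselKernel q s := by
    intro s
    rw [besselKernel, ← tsum_mul_left]
    congr 1; ext n; simp only [hF]; ring
  simp_rw [e1, e2] at key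
  rw [← key, besselSeries, Summable.tsum_eq_zero_add]
  · have h3 : (m ! : ℂ) ≠ 0 := by exact_mod_cast (Nat.factorial_pos _).ne'
    simp [h3]
  · exact Summable.of_norm_bounded (Real.summable_pow_div_factorial ‖q‖)
      fun n => norm_besselSeries_term_le m n le_rfl

lemma norm_pow_div_Gamma {α : ℝ} (hα : 0 < α) (w : ℂ) (m : ℕ) :
    ‖w ^ m / (Real.Gamma (α * m + 1) : ℂ)‖ = ‖w‖ ^ m / Real.Gamma (α * m + 1) := by
  rw [norm_div, norm_pow, Complex.norm_real, Real.norm_of_nonneg (Gamma_arg_pos hα m).le]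

lemma continuous_mittagLeffler {α : ℝ} (hα : 0 < α) : Continuous (mittagLeffler α) := by
  refine continuous_iff_continuousAt.2 fun w => ?_
  have : ContinuousOn (mittagLeffler α) (Metric.ball 0 (‖w‖ + 1)) := by
    refine continuousOn_tsum (fun m => by fun_prop)
      (summable_pow_div_Gamma hα (show 0 ≤ ‖w‖ + 1 by positivity)) fun m z hz => ?_
    rw [norm_pow_div_Gamma hα]
    have := (mem_ball_zero_iff.1 hz).le
    have := Gamma_arg_pos hα m
    gcongr
  exact this.continuousAt (Metric.isOpen_ball.mem_nhds (by simp))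

/-- The moment weight s^m is absorbed into w^m, turning each s into a rescaling of the argument of
E_α. -/
lemma twoVarML_eq_integral {α : ℝ} (hα : 0 < α) (w q : ℂ) :
    twoVarML α w q = mittagLeffler α w +
      ∫ s in Ioc (0 : ℝ) 1, mittagLeffler α (s * w) * besselKernel q s := by
  set M : ℝ := ∑' n : ℕ, ‖q‖ * (‖q‖ ^ n / n !)
  set F : ℕ → ℝ → ℂ := fun m s =>
    w ^ m / (Real.Gamma (α * m + 1) : ℂ) * ((s : ℂ) ^ m * besselKernel q s) with hF
  have hFb : ∀ m, ∀ s ∈ Ioc (0 : ℝ) 1, ‖F m s‖ ≤ ‖w‖ ^ m / Real.Gamma (α * m + 1) * M := by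
    intro m s hs
    have hs' := Ioc_subset_Icc_self hs
    have := Gamma_arg_pos hα m
    simp only [hF]
    rw [norm_mul, norm_pow_div_Gamma hα, norm_mul]
    calc _ ≤ ‖w‖ ^ m / Real.Gamma (α * m + 1) * (1 * M) := by
          gcongr
          · exact norm_ofReal_pow_le_one hs' m
          · exact norm_besselKernel_le le_rfl hs'
      _ = _ := by rw [one_mul]
  have hFi : ∀ m, Integrable (F m) (volume.restrict (Ioc (0 : ℝ) 1)) := fun m => by
    have h1 : Continuous fun s : ℝ => (s : ℂ) ^ m := by fun_prop
    have : ContinuousOn (F m) (Icc 0 1) :=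
      continuousOn_const.mul (h1.continuousOn.mul (continuousOn_besselKernel q))
    exact this.integrableOn_Icc.mono_set Ioc_subset_Icc_self
  have hFs : Summable fun m => ∫ s in Ioc (0 : ℝ) 1, ‖F m s‖ := by
    refine Summable.of_nonneg_of_le (fun n => integral_nonneg fun _ => norm_nonneg _) (fun m => ?_)
      ((summable_pow_div_Gamma hα (norm_nonneg w)).mul_right M)
    have := setIntegral_mono_on (hFi m).norm
      (integrable_const (‖w‖ ^ m / Real.Gamma (α * m + 1) * M)) measurableSet_Ioc (hFb m)
    simpa using this
  have key := hasSum_integral_of_summable_integral_norm hFi hFs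
  have e2 : ∀ s : ℝ, ∑' m, F m s = mittagLeffler α (s * w) * besselKernel q s := by
    intro s
    rw [mittagLeffler, ← tsum_mul_right]
    congr 1; ext m; simp only [hF, mul_pow]; ring
  simp_rw [e2] at key
  have h0 := (summable_norm_mittagLeffler hα w).of_norm.hasSum
  rw [twoVarML, mittagLeffler, ← (h0.add key).tsum_eq]
  congr 1; ext m
  simp only [hF]
  rw [integral_const_mul, besselSeries_eq_integral]; ring

/-! ### Exponential asymptotics with the Bessel factors -/

lemma ofReal_mul_cpow {T : ℝ} (hT : 0 < T) {v : ℂ} (hv : v ≠ 0) (α : ℝ) :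
    ((T : ℂ) * v) ^ (α : ℂ) = ((T ^ α : ℝ) : ℂ) * v ^ (α : ℂ) := by
  rw [Complex.cpow_def_of_ne_zero (mul_ne_zero (by exact_mod_cast hT.ne') hv),
    Complex.log_ofReal_mul hT hv, add_mul, Complex.exp_add,
    ← Complex.cpow_def_of_ne_zero hv, ← Complex.ofReal_mul, ← Complex.ofReal_exp,
    ← Real.rpow_def_of_pos hT]

/-- The exponential asymptotics of `twoVarML` for `w = v ^ α` with `v` in the right half-plane,
uniformly for bounded `q`. -/
lemma exists_norm_twoVarML_sub_exp_le {α : ℝ} (hα : 0 < α) (hα1 : α ≤ 1) {Q : ℝ} (hQ : 0 ≤ Q) :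
    ∃ C > 0, ∀ v q : ℂ, 0 < v.re → ‖q‖ ≤ Q →
      ‖twoVarML α (v ^ (α : ℂ)) q - Complex.exp v / α‖ ≤
        C * (1 + ‖v‖ + Real.exp v.re / v.re) := by
  obtain ⟨C, hC, hE⟩ := exists_norm_mittagLeffler_sub_exp_le hα hα1
  set M : ℝ := ∑' n : ℕ, Q * (Q ^ n / n !) with hM
  have hM0 : 0 ≤ M := tsum_nonneg fun n => by positivity
  refine ⟨C + M / α + C * M, by positivity, fun v q hv hq => ?_⟩
  have hv0 : v ≠ 0 := by rintro rfl; simp at hv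
  have hs : ∀ s ∈ Ioc (0 : ℝ) 1, ‖mittagLeffler α (s * v ^ (α : ℂ)) * besselKernel q s‖ ≤
      (M / α) * Real.exp (v.re * s) + C * (1 + ‖v‖) * M := by
    intro s hs
    have hsp : 0 < s := hs.1
    have hs' := Ioc_subset_Icc_self hs
    -- Then s v^α = (σv)^α, and σ ≤ s since 1/α ≥ 1 and s ≤ 1; this bounds the exponential by e^(s
    -- Re v).
    set σ : ℝ := s ^ (1 / α) with hσ
    have hσ0 : 0 < σ := by positivity
    have hσs : σ ≤ s := by
      have := Real.rpow_le_rpow_of_exponent_ge hsp hs.2 (show 1 ≤ 1 / α by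
        rw [le_div_iff₀ hα]; linarith)
      rwa [Real.rpow_one] at this
    have hpow : (s : ℂ) * v ^ (α : ℂ) = ((σ : ℂ) * v) ^ (α : ℂ) := by
      rw [ofReal_mul_cpow hσ0 hv0, hσ, ← Real.rpow_mul hsp.le,
        one_div_mul_cancel hα.ne', Real.rpow_one]
    have hre : ((σ : ℂ) * v).re = σ * v.re := by simp
    have h1 := hE ((σ : ℂ) * v) (by rw [hre]; positivity)
    have hn : ‖(σ : ℂ) * v‖ ≤ ‖v‖ := by
      rw [norm_mul, Complex.norm_real, Real.norm_of_nonneg hσ0.le]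
      exact mul_le_of_le_one_left (norm_nonneg _) (hσs.trans hs.2)
    have h2 : ‖Complex.exp ((σ : ℂ) * v) / α‖ ≤ Real.exp (v.re * s) / α := by
      rw [norm_div, Complex.norm_exp, hre, Complex.norm_real, Real.norm_of_nonneg hα.le]
      rw [mul_comm σ]
      gcongr
    rw [hpow, norm_mul]
    calc _ ≤ (C * (1 + ‖v‖) + Real.exp (v.re * s) / α) * M := by
          gcongr
          · have h4 := norm_le_norm_add_norm_sub' (mittagLeffler α (((σ : ℂ) * v) ^ (α : ℂ)))
              (Complex.exp ((σ : ℂ) * v) / α)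
            have h5 : C * (1 + ‖(σ : ℂ) * v‖) ≤ C * (1 + ‖v‖) := by gcongr
            linarith
          · exact norm_besselKernel_le hq hs'
      _ = _ := by ring
  -- Averaging over s gains the factor 1/Re v that makes the Bessel correction subordinate.
  have hexp : ∫ s in Ioc (0 : ℝ) 1, Real.exp (v.re * s) ≤ Real.exp v.re / v.re := by
    rw [← intervalIntegral.integral_of_le zero_le_one,
      intervalIntegral.integral_comp_mul_left _ hv.ne', integral_exp]
    simp only [mul_zero, mul_one, Real.exp_zero, smul_eq_mul]
    rw [div_eq_inv_mul]
    gcongr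
    linarith
  have hei : IntegrableOn (fun s : ℝ => Real.exp (v.re * s)) (Ioc 0 1) :=
    (Continuous.integrableOn_Icc (by fun_prop)).mono_set Ioc_subset_Icc_self
  have hint : ‖∫ s in Ioc (0 : ℝ) 1, mittagLeffler α (s * v ^ (α : ℂ)) * besselKernel q s‖ ≤
      (M / α) * (Real.exp v.re / v.re) + C * (1 + ‖v‖) * M := by
    refine (norm_integral_le_of_norm_le ((hei.const_mul (M / α)).add (integrable_const
      (C * (1 + ‖v‖) * M))) ((ae_restrict_mem measurableSet_Ioc).mono hs)).trans ?_
    simp only [Pi.add_apply]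
    rw [integral_add (hei.const_mul (M / α)) (integrable_const _), integral_const_mul]
    simp only [integral_const, smul_eq_mul]
    simp only [measureReal_restrict_apply MeasurableSet.univ, univ_inter, Real.volume_real_Ioc]
    norm_num
    gcongr
  rw [twoVarML_eq_integral hα]
  have hx : 0 < Real.exp v.re / v.re := by positivity
  have e : ∀ a b c : ℂ, a + b - c = (a - c) + b := fun a b c => by ring
  rw [e]
  refine (norm_add_le _ _).trans ((add_le_add (hE v hv) hint).trans ?_)
  set x := Real.exp v.re / v.re
  have h1 : 0 ≤ M / α * (1 + ‖v‖) := by positivity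
  have h2 : 0 ≤ C * x := by positivity
  have h3 : 0 ≤ C * M * x := by positivity
  linarith [show (C + M / α + C * M) * (1 + ‖v‖ + x) = C * (1 + ‖v‖) + C * x + M / α * (1 + ‖v‖) + M / α * x + C * (1 + ‖v‖) * M + C * M * x by ring]

/-! ### Joint holomorphy and the link with the plane -/

lemma summable_nat_mul_pow_div_Gamma {α : ℝ} (hα : 0 < α) {A : ℝ} (hA : 0 ≤ A) :
    Summable fun m : ℕ => m * A ^ (m - 1) / Real.Gamma (α * m + 1) := by
  refine Summable.of_nonneg_of_le (fun m => div_nonneg (by positivity) (Gamma_arg_pos hα m).le)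
    (fun m => ?_) (summable_pow_div_Gamma hα (show 0 ≤ 2 * (A + 1) by positivity))
  have h1 : (m : ℝ) ≤ 2 ^ m := by exact_mod_cast m.lt_two_pow_self.le
  have h2 : A ^ (m - 1) ≤ (A + 1) ^ m :=
    calc A ^ (m - 1) ≤ (A + 1) ^ (m - 1) := by gcongr; linarith
      _ ≤ (A + 1) ^ m := pow_le_pow_right₀ (by linarith) (Nat.sub_le m 1)
  rw [mul_pow]
  have := Gamma_arg_pos hα m
  gcongr

/-- Termwise differentiation on a ball: the Bessel factors and their derivatives are bounded there
uniformly in m, so the series in w controls convergence. -/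
lemma differentiable_twoVarML {α : ℝ} (hα : 0 < α) :
    Differentiable ℂ fun p : ℂ × ℂ => twoVarML α p.1 p.2 := by
  intro p
  set A : ℝ := ‖p‖ + 1 with hA
  have hA0 : 0 < A := by positivity
  set g : ℕ → ℂ := fun m => (Real.Gamma (α * m + 1) : ℂ)
  have hderiv : ∀ m : ℕ, ∀ x : ℂ × ℂ, x ∈ Metric.ball (0 : ℂ × ℂ) A →
      HasFDerivAt (fun x : ℂ × ℂ => x.1 ^ m / g m * besselSeries m x.2)
        ((x.1 ^ m / g m) • (deriv (besselSeries m) x.2 • ContinuousLinearMap.snd ℂ ℂ ℂ) +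
          besselSeries m x.2 • ((m * x.1 ^ (m - 1) / g m) • ContinuousLinearMap.fst ℂ ℂ ℂ)) x := by
    intro m x _
    have h1 : HasFDerivAt (fun x : ℂ × ℂ => x.1 ^ m / g m)
        ((m * x.1 ^ (m - 1) / g m) • ContinuousLinearMap.fst ℂ ℂ ℂ) x :=
      ((hasDerivAt_pow m x.1).div_const (g m)).comp_hasFDerivAt x hasFDerivAt_fst
    have h2 : HasFDerivAt (fun x : ℂ × ℂ => besselSeries m x.2)
        (deriv (besselSeries m) x.2 • ContinuousLinearMap.snd ℂ ℂ ℂ) x :=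
      ((differentiable_besselSeries m x.2).hasDerivAt).comp_hasFDerivAt x hasFDerivAt_snd
    exact h1.mul h2
  have hbound : ∀ m : ℕ, ∀ x : ℂ × ℂ, x ∈ Metric.ball (0 : ℂ × ℂ) A →
      ‖(x.1 ^ m / g m) • (deriv (besselSeries m) x.2 • ContinuousLinearMap.snd ℂ ℂ ℂ) +
          besselSeries m x.2 • ((m * x.1 ^ (m - 1) / g m) • ContinuousLinearMap.fst ℂ ℂ ℂ)‖ ≤
        A ^ m / Real.Gamma (α * m + 1) * Real.exp (A + 1) +
          Real.exp A * (m * A ^ (m - 1) / Real.Gamma (α * m + 1)) := by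
    intro m x hx
    have hxA : ‖x‖ ≤ A := (mem_ball_zero_iff.1 hx).le
    have hx1 : ‖x.1‖ ≤ A := (norm_fst_le x).trans hxA
    have hx2 : ‖x.2‖ ≤ A := (norm_snd_le x).trans hxA
    have hG := Gamma_arg_pos hα m
    have hgn : ‖g m‖ = Real.Gamma (α * m + 1) := by
      simp only [g]; rw [Complex.norm_real, Real.norm_of_nonneg hG.le]
    refine (norm_add_le _ _).trans ?_
    simp only [norm_smul, norm_div, norm_mul, norm_pow, hgn, Complex.norm_natCast]
    have hf := ContinuousLinearMap.norm_fst_le ℂ ℂ ℂ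
    have hs := ContinuousLinearMap.norm_snd_le ℂ ℂ ℂ
    have hd := norm_deriv_besselSeries_le m hx2
    have hb := norm_besselSeries_le m hx2
    calc _ ≤ A ^ m / Real.Gamma (α * m + 1) * (Real.exp (A + 1) * 1) +
          Real.exp A * (m * A ^ (m - 1) / Real.Gamma (α * m + 1) * 1) := by gcongr
      _ = _ := by rw [mul_one, mul_one]
  have hsum : Summable fun m : ℕ => A ^ m / Real.Gamma (α * m + 1) * Real.exp (A + 1) +
          Real.exp A * (m * A ^ (m - 1) / Real.Gamma (α * m + 1)) :=
    ((summable_pow_div_Gamma hα hA0.le).mul_right _).add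
      ((summable_nat_mul_pow_div_Gamma hα hA0.le).mul_left _)
  have h0 : Summable fun m : ℕ => (0 : ℂ × ℂ).1 ^ m / g m * besselSeries m (0 : ℂ × ℂ).2 := by
    refine summable_of_ne_finset_zero (s := {0}) fun m hm => ?_
    simp only [Finset.mem_singleton] at hm
    simp [zero_pow hm]
  exact (hasFDerivAt_tsum_of_isPreconnected hsum Metric.isOpen_ball
    (convex_ball (0 : ℂ × ℂ) A).isPreconnected hderiv hbound (Metric.mem_ball_self hA0) h0
    (show p ∈ Metric.ball (0 : ℂ × ℂ) A by simp [hA])).differentiableAt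

lemma differentiable_twoVarML_comp {α : ℝ} (hα : 0 < α) {f g : ℂ → ℂ} (hf : Differentiable ℂ f)
    (hg : Differentiable ℂ g) : Differentiable ℂ fun ζ => twoVarML α (f ζ) (g ζ) :=
  Differentiable.comp (g := fun p : ℂ × ℂ => twoVarML α p.1 p.2) (f := fun ζ => (f ζ, g ζ))
    (differentiable_twoVarML hα) (hf.prodMk hg)

lemma besselHat_eq_besselSeries (m : ℕ) (t : ℝ) :
    (besselHat m t : ℂ) = besselSeries m ((t / 2 : ℝ) ^ 2 : ℂ) := by
  rw [besselHat, besselSeries]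
  split_ifs with h
  · rw [tsum_eq_single 0]
    · have h3 : (m ! : ℂ) ≠ 0 := by exact_mod_cast (Nat.factorial_pos _).ne'
      simp [h3]
    · intro n hn; simp [h, hn]
  · have e : (2 / t) ^ m * (m ! : ℝ) * besselJ m t =
        ∑' n : ℕ, (m ! : ℝ) * ((-1 : ℝ) ^ n / ((m + n)! * n ! : ℝ) * (t / 2) ^ (2 * n)) := by
      rw [besselJ, tsum_mul_left]
      have : (2 / t) ^ m * (t / 2) ^ m = 1 := by rw [← mul_pow]; field_simp; simp
      linear_combination (m ! : ℝ) *
        (∑' n : ℕ, (-1 : ℝ) ^ n / ((m + n)! * n ! : ℝ) * (t / 2) ^ (2 * n)) * this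
    rw [e, Complex.ofReal_tsum]
    congr 1; ext n
    push_cast
    rw [neg_pow (((t : ℂ) / 2) ^ 2), ← pow_mul]; ring

/-- Only |x|² enters the Bessel factors, and x₁² + x₂² is a polynomial, so the function extends
holomorphically to complexified lines. -/
lemma modML_eq_twoVarML (k α τ : ℝ) (x : Plane) :
    modML k α τ x = twoVarML α (τ * toComplex x)
      ((k ^ 2 / 4 : ℝ) * ((x 0 : ℂ) ^ 2 + (x 1 : ℂ) ^ 2)) := by
  rw [modML, twoVarML]
  congr 1; ext m
  rw [besselHat_eq_besselSeries]
  congr 2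
  have h : ‖x‖ ^ 2 = x 0 ^ 2 + x 1 ^ 2 := by
    rw [EuclideanSpace.norm_sq_eq]; simp
  have : (k * ‖x‖ / 2) ^ 2 = k ^ 2 / 4 * (x 0 ^ 2 + x 1 ^ 2) := by rw [← h]; ring
  rw [← Complex.ofReal_pow, this]
  push_cast; ring

/-! ### Uniform relative errors on complex neighbourhoods -/

lemma exists_norm_twoVarML_mul_exp_sub_one_le {α : ℝ} (hα : 0 < α) (hα1 : α ≤ 1) {ε V Q : ℝ}
    (hε : 0 < ε) (hV : 0 ≤ V) (hQ : 0 ≤ Q) :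
    ∃ C > 0, ∀ T : ℝ, 1 ≤ T → ∀ v q : ℂ, ε ≤ v.re → ‖v‖ ≤ V → ‖q‖ ≤ Q →
      ‖twoVarML α ((T * v) ^ (α : ℂ)) q * (α * Complex.exp (-(T * v))) - 1‖ ≤ C / T := by
  obtain ⟨C, hC, h⟩ := exists_norm_twoVarML_sub_exp_le hα hα1 hQ
  refine ⟨α * C * (2 * (1 + V) / ε ^ 2 + 1 / ε), by positivity, fun T hT v q hv hvV hq => ?_⟩
  have hT0 : 0 < T := by linarith
  have hre : ((T : ℂ) * v).re = T * v.re := by simp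
  have hTε : T * ε ≤ T * v.re := by gcongr
  have hpos : 0 < T * v.re := lt_of_lt_of_le (by positivity) hTε
  have h1 := h (T * v) q (by rwa [hre]) hq
  have hαc : (α : ℂ) ≠ 0 := by exact_mod_cast hα.ne'
  have e : twoVarML α ((T * v) ^ (α : ℂ)) q * (α * Complex.exp (-(T * v))) - 1 =
      (twoVarML α ((T * v) ^ (α : ℂ)) q - Complex.exp (T * v) / α) *
        (α * Complex.exp (-(T * v))) := by
    have h2 : Complex.exp (T * v) * Complex.exp (-(T * v)) = 1 := by
      rw [← Complex.exp_add, add_neg_cancel, Complex.exp_zero]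
    field_simp
    linear_combination h2
  rw [hre] at h1
  have hn : ‖(T : ℂ) * v‖ ≤ T * V := by
    rw [norm_mul, Complex.norm_real, Real.norm_of_nonneg hT0.le]; gcongr
  -- Quadratic decay is what is needed: multiplied by the linear growth 1 + TV it leaves O(1/T).
  have hexp : Real.exp (-(T * v.re)) ≤ 2 / (T * ε) ^ 2 := by
    rw [Real.exp_neg, inv_le_comm₀ (Real.exp_pos _) (by positivity), inv_div]
    have h2 := Real.quadratic_le_exp_of_nonneg hpos.le
    have h3 : (T * ε) ^ 2 ≤ (T * v.re) ^ 2 := by gcongr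
    linarith
  rw [e, norm_mul, norm_mul, Complex.norm_exp, Complex.neg_re, hre, Complex.norm_real,
    Real.norm_of_nonneg hα.le]
  calc _ ≤ C * (1 + T * V + Real.exp (T * v.re) / (T * v.re)) *
        (α * Real.exp (-(T * v.re))) := by
        gcongr
        refine h1.trans ?_
        gcongr
    _ = α * C * ((1 + T * V) * Real.exp (-(T * v.re)) + 1 / (T * v.re)) := by
        rw [Real.exp_neg]; field_simp
    _ ≤ α * C * (T * (1 + V) * (2 / (T * ε) ^ 2) + 1 / (T * ε)) := by
        gcongr
        nlinarith
    _ = _ := by field_simp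

/-- The truncated sectors `|arg z| < πα/2`, `Re z^(1/α) ≥ ε`, `|z^(1/α)| ≤ V` have a uniform
complex neighbourhood inside a slightly larger truncated sector. -/
lemma exists_uniform_sector_nhds {α : ℝ} (hα : 0 < α) (hα1 : α ≤ 1) {ε V : ℝ}
    (hε : 0 < ε) (hV : 0 < V) :
    ∃ η > 0, ∀ z : ℂ, z ≠ 0 → |z.arg| < Real.pi * α / 2 → ε ≤ (z ^ ((1 / α : ℝ) : ℂ)).re →
      ‖z ^ ((1 / α : ℝ) : ℂ)‖ ≤ V → ∀ z' : ℂ, ‖z' - z‖ ≤ η → z' ∈ Complex.slitPlane ∧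
        |z'.arg| < Real.pi * α / 2 ∧ ε / 2 ≤ (z' ^ ((1 / α : ℝ) : ℂ)).re ∧
        ‖z' ^ ((1 / α : ℝ) : ℂ)‖ ≤ 2 * V := by
  set S : Set ℂ := {v | ε ≤ v.re ∧ ‖v‖ ≤ V} with hS
  have hScpt : IsCompact S := by
    refine Metric.isCompact_of_isClosed_isBounded
      ((isClosed_le continuous_const Complex.continuous_re).inter
        (isClosed_le continuous_norm continuous_const)) ?_
    exact (Metric.isBounded_closedBall (x := (0 : ℂ)) (r := V)).subset fun v hv => by
      simpa using hv.2
  have hSs : ∀ v ∈ S, v ∈ Complex.slitPlane := fun v hv => Or.inl (hε.trans_le hv.1)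
  have hK : IsCompact ((fun v : ℂ => v ^ (α : ℂ)) '' S) := hScpt.image_of_continuousOn
    fun v hv => (continuousAt_id.cpow continuousAt_const (hSs v hv)).continuousWithinAt
  set W : Set (ℝ × ℂ) := {p | |p.1| < Real.pi * α / 2 ∧ ε / 2 < p.2.re ∧ ‖p.2‖ < 2 * V} with hW
  have hWo : IsOpen W :=
    (isOpen_lt continuous_fst.abs continuous_const).inter
      ((isOpen_lt continuous_const (Complex.continuous_re.comp continuous_snd)).inter
        (isOpen_lt continuous_snd.norm continuous_const))
  have hfc : ContinuousOn (fun z : ℂ => (z.arg, z ^ ((1 / α : ℝ) : ℂ))) Complex.slitPlane :=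
    fun z hz => ((Complex.continuousAt_arg hz).prodMk
      (continuousAt_id.cpow continuousAt_const hz)).continuousWithinAt
  have hUo := hfc.isOpen_inter_preimage Complex.isOpen_slitPlane hWo
  have hKU : (fun v : ℂ => v ^ (α : ℂ)) '' S ⊆
      Complex.slitPlane ∩ (fun z : ℂ => (z.arg, z ^ ((1 / α : ℝ) : ℂ))) ⁻¹' W := by
    rintro _ ⟨v, hv, rfl⟩
    have hv0 := Complex.slitPlane_ne_zero (hSs v hv)
    have hlt := abs_mul_arg_lt hα hα1 (hSs v hv)
    have harg : (v ^ (α : ℂ)).arg = α * v.arg := by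
      rw [← Complex.log_im, log_cpow_ofReal hv0 hlt]; simp [Complex.log_im]
    have hv2 : |v.arg| < Real.pi / 2 :=
      Complex.abs_arg_lt_pi_div_two_iff.2 (Or.inl (hε.trans_le hv.1))
    refine ⟨cpow_mem_slitPlane hv0 hlt, ?_⟩
    simp only [mem_preimage, hW, mem_ofPred_eq]
    rw [cpow_cpow_inv hα hv0 hlt, harg, abs_mul, abs_of_pos hα]
    refine ⟨?_, by linarith [hv.1], by linarith [hv.2]⟩
    nlinarith
  -- The truncated sector lies in the image under v ↦ v^α of the compact set S, and that image lies
  -- in an open set given by the weaker constraints; compactness supplies a uniform radius.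
  obtain ⟨η, hη, hsub⟩ := hK.exists_cthickening_subset_open hUo hKU
  refine ⟨η, hη, fun z hz0 harg hre hn z' hz' => ?_⟩
  have hzK : z ∈ (fun v : ℂ => v ^ (α : ℂ)) '' S := by
    refine ⟨z ^ ((1 / α : ℝ) : ℂ), ⟨hre, hn⟩, ?_⟩
    have hb : |1 / α * z.arg| < Real.pi := by
      rw [abs_mul, abs_of_pos (by positivity), one_div_mul_eq_div, div_lt_iff₀ hα]
      nlinarith [Real.pi_pos]
    have := cpow_cpow_inv (α := 1 / α) (by positivity) hz0 hb
    rwa [one_div_one_div] at this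
  have hmem := hsub (Metric.mem_cthickening_of_dist_le z' z η _ hzK (by rwa [dist_eq_norm]))
  exact ⟨hmem.1, hmem.2.1, hmem.2.2.1.le, hmem.2.2.2.le⟩

lemma toComplex_add_smul (x e : Plane) (t : ℝ) :
    toComplex (x + t • e) = toComplex x + t * toComplex e := by
  simp only [toComplex, PiLp.add_apply, PiLp.smul_apply, smul_eq_mul]
  push_cast; ring

lemma norm_toComplex (x : Plane) : ‖toComplex x‖ = ‖x‖ := by
  rw [EuclideanSpace.norm_eq, toComplex, mul_comm, Complex.norm_def, Complex.normSq_add_mul_I]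
  simp

lemma abs_arg_toComplex_lt {α : ℝ} (hα : 0 < α) {x : Plane} (hx : x ∈ cone α) :
    |(toComplex x).arg| < Real.pi * α / 2 := by
  by_contra h
  have h' := not_lt.1 h
  have hcos : Real.cos |(toComplex x).arg| ≤ Real.cos (Real.pi * α / 2) :=
    Real.cos_le_cos_of_nonneg_of_le_pi (by positivity) (Complex.abs_arg_le_pi _) h'
  rw [Real.cos_abs] at hcos
  have h1 : ‖toComplex x‖ * Real.cos (toComplex x).arg = x 0 := by
    rw [Complex.norm_mul_cos_arg]; simp [toComplex]
  have hx' : ‖x‖ * Real.cos (Real.pi * α / 2) < x 0 := hx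
  rw [norm_toComplex] at h1
  have := mul_le_mul_of_nonneg_left hcos (norm_nonneg x)
  linarith

lemma differentiable_toComplex : Differentiable ℝ toComplex := by
  unfold toComplex
  fun_prop

lemma differentiable_modML {α : ℝ} (hα : 0 < α) (k τ : ℝ) :
    Differentiable ℝ (modML k α τ) := by
  have : modML k α τ = (fun p : ℂ × ℂ => twoVarML α p.1 p.2) ∘ fun x : Plane =>
      ((τ : ℂ) * toComplex x, (k ^ 2 / 4 : ℝ) * ((x 0 : ℂ) ^ 2 + (x 1 : ℂ) ^ 2)) :=
    funext (modML_eq_twoVarML k α τ)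
  rw [this]
  have h1 := differentiable_toComplex
  exact ((differentiable_twoVarML hα).restrictScalars ℝ).comp (by fun_prop)

lemma differentiableAt_leadingTerm (α τ : ℝ) {x : Plane}
    (hx : toComplex x ∈ Complex.slitPlane) : DifferentiableAt ℝ (leadingTerm α τ) x := by
  have h : DifferentiableAt ℂ (fun z : ℂ => (1 / α : ℂ) *
      Complex.exp (((τ ^ (1 / α) : ℝ) : ℂ) * z ^ ((1 / α : ℝ) : ℂ))) (toComplex x) :=
    (((differentiableAt_id.cpow_const hx).const_mul _).cexp).const_mul _
  exact (h.restrictScalars ℝ).comp x (differentiable_toComplex x)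

lemma abs_apply_le_norm (x : Plane) (i : Fin 2) : ‖(x i : ℂ)‖ ≤ ‖x‖ := by
  rw [Complex.norm_real]; exact PiLp.norm_apply_le x i

/-- The leading term factors out of `modML` and of its derivative along a unit vector. -/
lemma exists_line_expansion {α : ℝ} (hα : 0 < α) (hα1 : α ≤ 1) (k : ℝ) {R ε : ℝ}
    (hR : 0 < R) (hε : 0 < ε) :
    ∃ C > 0, ∀ τ : ℝ, 1 ≤ τ → ∀ x ∈ region α R ε, ∀ e : Plane, ‖e‖ = 1 →
      toComplex x ∈ Complex.slitPlane ∧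
      ∃ D D' : ℂ, ‖D‖ ≤ C / τ ^ (1 / α) ∧ ‖D'‖ ≤ C / τ ^ (1 / α) ∧
        modML k α τ x = leadingTerm α τ x * (1 + D) ∧
        HasDerivAt (fun t : ℝ => leadingTerm α τ (x + t • e))
          (leadingTerm α τ x * (((τ ^ (1 / α) : ℝ) : ℂ) * ((1 / α : ℝ) *
            toComplex x ^ (((1 / α : ℝ) : ℂ) - 1) * toComplex e))) 0 ∧
        HasDerivAt (fun t : ℝ => modML k α τ (x + t • e))
          (leadingTerm α τ x * (((τ ^ (1 / α) : ℝ) : ℂ) * ((1 / α : ℝ) *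
            toComplex x ^ (((1 / α : ℝ) : ℂ) - 1) * toComplex e)) * (1 + D) +
            leadingTerm α τ x * D') 0 := by
  set V : ℝ := R ^ (1 / α) with hVdef
  have hV : 0 < V := by positivity
  obtain ⟨η, hη, hnb⟩ := exists_uniform_sector_nhds hα hα1 hε hV
  set Q : ℝ := k ^ 2 / 4 * ((R + η) ^ 2 + (R + η) ^ 2) with hQdef
  have hQ : 0 ≤ Q := by positivity
  -- The constants ε/2, 2V and Q are those valid on the η-neighbourhood, not only on the region
  -- itself.
  obtain ⟨C, hC, hasym⟩ := exists_norm_twoVarML_mul_exp_sub_one_le hα hα1 (half_pos hε)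
    (show 0 ≤ 2 * V by positivity) hQ
  refine ⟨max C (C / η), by positivity, fun τ hτ x hx e he => ?_⟩
  have hτ0 : 0 < τ := by linarith
  obtain ⟨hcone, hxl, hxu, hxε⟩ := hx
  set T : ℝ := τ ^ (1 / α) with hT
  have hT1 : 1 ≤ T := Real.one_le_rpow hτ (by positivity)
  have hT0 : 0 < T := by linarith
  have hTα : T ^ α = τ := by
    rw [hT, ← Real.rpow_mul hτ0.le, one_div_mul_cancel hα.ne', Real.rpow_one]
  set z := toComplex x with hz
  set c := toComplex e with hc
  have hcn : ‖c‖ = 1 := by rw [hc, norm_toComplex, he]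
  have hzn : ‖z‖ = ‖x‖ := norm_toComplex x
  have hz0 : z ≠ 0 := by
    rw [← norm_pos_iff, hzn]; exact lt_of_lt_of_le (by positivity) hxl
  have hzV : ‖z ^ ((1 / α : ℝ) : ℂ)‖ ≤ V := by
    rw [norm_cpow_ofReal hz0, hzn, hVdef]
    gcongr
  have hsec := hnb z hz0 (abs_arg_toComplex_lt hα hcone) hxε hzV
  -- The line x + t e with complex parameter ζ: Z extends x₁ + i x₂ and q extends (k|x|/2)². These
  -- are independent, since |x|² no longer equals |Z|² off the real line.
  set Z : ℂ → ℂ := fun ζ => z + ζ * c with hZ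
  set q : ℂ → ℂ := fun ζ => (k ^ 2 / 4 : ℝ) *
    (((x 0 : ℂ) + ζ * (e 0 : ℂ)) ^ 2 + ((x 1 : ℂ) + ζ * (e 1 : ℂ)) ^ 2) with hq
  have hZn : ∀ ζ : ℂ, ‖ζ‖ ≤ η → ‖Z ζ - z‖ ≤ η := fun ζ h => by
    simp only [hZ, add_sub_cancel_left]; rwa [norm_mul, hcn, mul_one]
  set L : ℂ → ℂ := fun ζ => (1 / α : ℂ) * Complex.exp ((T : ℂ) * Z ζ ^ ((1 / α : ℝ) : ℂ)) with hL
  set P : ℂ → ℂ := fun ζ => twoVarML α (τ * Z ζ) (q ζ) with hP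
  set D : ℂ → ℂ := fun ζ => P ζ * (α * Complex.exp (-((T : ℂ) * Z ζ ^ ((1 / α : ℝ) : ℂ)))) - 1
    with hD
  have hαc : (α : ℂ) ≠ 0 := by exact_mod_cast hα.ne'
  have hPL : ∀ ζ, P ζ = L ζ * (1 + D ζ) := by
    intro ζ
    simp only [hD, hL, add_sub_cancel]
    rw [Complex.exp_neg]
    field_simp [Complex.exp_ne_zero]
  have hPd : Differentiable ℂ P := by
    have hZd : Differentiable ℂ fun ζ => (τ : ℂ) * Z ζ := by simp only [hZ]; fun_prop
    have hqd : Differentiable ℂ q := by simp only [hq]; fun_prop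
    exact differentiable_twoVarML_comp hα hZd hqd
  have hDd : ∀ ζ : ℂ, ‖ζ‖ ≤ η → DifferentiableAt ℂ D ζ := by
    intro ζ hζ
    have hs := (hsec (Z ζ) (hZn ζ hζ)).1
    have h1 : DifferentiableAt ℂ Z ζ := by simp only [hZ]; fun_prop
    have h2 : DifferentiableAt ℂ (fun ζ => Z ζ ^ ((1 / α : ℝ) : ℂ)) ζ := h1.cpow_const hs
    have h3 : DifferentiableAt ℂ P ζ := hPd ζ
    clear_value P Z
    simp only [hD]
    fun_prop
  have hDb : ∀ ζ : ℂ, ‖ζ‖ ≤ η → ‖D ζ‖ ≤ C / T := by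
    intro ζ hζ
    obtain ⟨hs, harg, hre, hn⟩ := hsec (Z ζ) (hZn ζ hζ)
    have hZ0 := Complex.slitPlane_ne_zero hs
    have hqn : ‖q ζ‖ ≤ Q := by
      have hi : ∀ i : Fin 2, ‖(x i : ℂ) + ζ * (e i : ℂ)‖ ≤ R + η := fun i => by
        refine (norm_add_le _ _).trans (add_le_add ((abs_apply_le_norm x i).trans hxu) ?_)
        rw [norm_mul]
        calc ‖ζ‖ * ‖(e i : ℂ)‖ ≤ η * 1 := by
              gcongr; exact (abs_apply_le_norm e i).trans he.le
          _ = η := mul_one η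
      simp only [hq, hQdef]
      rw [norm_mul, Complex.norm_real, Real.norm_of_nonneg (by positivity)]
      gcongr
      refine (norm_add_le _ _).trans ?_
      rw [norm_pow, norm_pow]
      gcongr
      · exact hi 0
      · exact hi 1
    have hv0 : Z ζ ^ ((1 / α : ℝ) : ℂ) ≠ 0 := by
      intro h0; rw [h0, Complex.zero_re] at hre; linarith
    have h := hasym T hT1 (Z ζ ^ ((1 / α : ℝ) : ℂ)) (q ζ) hre hn hqn
    have hb : |1 / α * (Z ζ).arg| < Real.pi := by
      rw [abs_mul, abs_of_pos (by positivity), one_div_mul_eq_div, div_lt_iff₀ hα]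
      nlinarith [Real.pi_pos]
    have hback := cpow_cpow_inv (α := 1 / α) (by positivity) hZ0 hb
    rw [one_div_one_div] at hback
    rw [ofReal_mul_cpow hT0 hv0, hTα, hback] at h
    exact h
  -- Cauchy's inequality on the circle of radius η, which does not depend on x or τ.
  have hD' : ‖deriv D 0‖ ≤ C / T / η := by
    refine Complex.norm_deriv_le_of_forall_mem_sphere_norm_le hη ?_ fun ζ hζ =>
      hDb ζ (by simpa using hζ.le)
    refine DifferentiableOn.diffContOnCl fun ζ hζ => ?_
    rw [closure_ball _ hη.ne', mem_closedBall_zero_iff] at hζ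
    exact (hDd ζ hζ).differentiableWithinAt
  have hs0 : z ∈ Complex.slitPlane := (hsec z (by simp [hη.le])).1
  have hZ00 : Z 0 = z := by simp [hZ]
  have hL0 : L 0 = leadingTerm α τ x := by simp only [hL, hZ00, leadingTerm, hT, hz]
  have hLd : HasDerivAt L (L 0 * ((T : ℂ) * ((1 / α : ℝ) *
      z ^ (((1 / α : ℝ) : ℂ) - 1) * c))) 0 := by
    have h1 : HasDerivAt Z c 0 := by
      simpa [hZ] using ((hasDerivAt_id (0 : ℂ)).mul_const c).const_add z
    have h2 := (((h1.cpow_const (c := ((1 / α : ℝ) : ℂ)) (by rwa [hZ00])).const_mul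
      (T : ℂ)).cexp).const_mul (1 / α : ℂ)
    refine h2.congr_deriv ?_
    simp only [hL, hZ00]
    ring
  have hPder : HasDerivAt P (L 0 * ((T : ℂ) * ((1 / α : ℝ) *
      z ^ (((1 / α : ℝ) : ℂ) - 1) * c)) * (1 + D 0) + L 0 * deriv D 0) 0 := by
    rw [show P = fun ζ => L ζ * (1 + D ζ) from funext hPL]
    exact hLd.mul ((hDd 0 (by simp [hη.le])).hasDerivAt.const_add 1)
  have hmod : ∀ t : ℝ, modML k α τ (x + t • e) = P t := by
    intro t
    rw [modML_eq_twoVarML, toComplex_add_smul]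
    simp only [hP, hZ, hq, PiLp.add_apply, PiLp.smul_apply, smul_eq_mul]
    push_cast; rfl
  have hlead : ∀ t : ℝ, leadingTerm α τ (x + t • e) = L t := by
    intro t
    rw [leadingTerm, toComplex_add_smul]
  refine ⟨hs0, D 0, deriv D 0, (hDb 0 (by simp [hη.le])).trans ?_, hD'.trans ?_, ?_, ?_, ?_⟩
  · gcongr; exact le_max_left _ _
  · rw [div_right_comm]; gcongr; exact le_max_right _ _
  · have := hmod 0
    rw [zero_smul, add_zero] at this
    rw [this, Complex.ofReal_zero, hPL 0, hL0]
  · simp_rw [hlead]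
    rw [← hL0]
    exact HasDerivAt.comp_ofReal (z := 0) (by simpa using hLd)
  · simp_rw [hmod]
    rw [← hL0]
    exact HasDerivAt.comp_ofReal (z := 0) (by simpa using hPder)

end ModifiedMittagLeffler

end

theorem proposition2p2 (k α R ε : ℝ) (hk : 0 ≤ k) (hα : 0 < α) (hα1 : α ≤ 1)
    (hR : 0 < R) (hε : 0 < ε) :
    ∃ C > (0 : ℝ), ∃ τ₀ > (0 : ℝ), ∀ τ ≥ τ₀, ∀ x ∈ ModifiedMittagLeffler.region α R ε,
      (∃ δ : ℂ, ‖δ‖ ≤ C / τ ^ (1 / α) ∧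
        ModifiedMittagLeffler.modML k α τ x =
          ModifiedMittagLeffler.leadingTerm α τ x * (1 + δ)) ∧
      DifferentiableAt ℝ (ModifiedMittagLeffler.modML k α τ) x ∧
      DifferentiableAt ℝ (ModifiedMittagLeffler.leadingTerm α τ) x ∧
      (∀ j : Fin 2, ∃ δ : ℂ, ‖δ‖ ≤ C / τ ^ (1 / α) ∧
        ModifiedMittagLeffler.partialDeriv j (ModifiedMittagLeffler.modML k α τ) x =
          ModifiedMittagLeffler.partialDeriv j (ModifiedMittagLeffler.leadingTerm α τ) x *
            (1 + δ)) ∧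
      1 / (2 * α) * Real.exp (ε * τ ^ (1 / α)) ≤ ‖ModifiedMittagLeffler.modML k α τ x‖ := by
  open ModifiedMittagLeffler in
  obtain ⟨C, hC, h⟩ := exists_line_expansion hα hα1 k hR hε
  have hβ : 1 ≤ 1 / α := by rw [le_div_iff₀ hα]; linarith
  -- A lower bound for the logarithmic derivative G of the leading term along a unit vector, from
  -- |x| ≥ R⁻¹, T ≥ 1 and 1/α ≥ 1.
  set B : ℝ := R⁻¹ ^ (1 / α - 1) with hB
  have hB0 : 0 < B := by positivity
  -- For τ ≥ 1 one has T ≥ τ, so τ ≥ 2C forces |D| ≤ 1/2 and hence the exponential lower bound.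
  refine ⟨C * (1 + 1 / B), by positivity, max 1 (2 * C), by positivity, fun τ hτ x hx => ?_⟩
  have hτ1 : 1 ≤ τ := (le_max_left _ _).trans hτ
  have hτ2 : 2 * C ≤ τ := (le_max_right _ _).trans hτ
  set T : ℝ := τ ^ (1 / α) with hT
  have hτT : τ ≤ T := by
    have := Real.rpow_le_rpow_of_exponent_le hτ1 hβ
    rwa [Real.rpow_one] at this
  have hT0 : 0 < T := by linarith
  have hCT : C / T ≤ C * (1 + 1 / B) / T := by
    gcongr
    have : 0 ≤ 1 / B := by positivity
    nlinarith
  have h0 := h τ hτ1 x hx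
  have hunit : ∀ j : Fin 2, ‖(EuclideanSpace.single j 1 : Plane)‖ = 1 := fun j => by simp
  obtain ⟨hs, D, D', hD, -, heq, -, -⟩ := h0 _ (hunit 0)
  refine ⟨⟨D, hD.trans hCT, heq⟩, differentiable_modML hα k τ x,
    differentiableAt_leadingTerm α τ hs, fun j => ?_, ?_⟩
  · obtain ⟨-, D, D', hD, hD', -, hl, hm⟩ := h0 _ (hunit j)
    have hz0 := Complex.slitPlane_ne_zero hs
    set G : ℂ := (T : ℂ) * ((1 / α : ℝ) * toComplex x ^ (((1 / α : ℝ) : ℂ) - 1) *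
      toComplex (EuclideanSpace.single j 1)) with hG
    have hGn : B ≤ ‖G‖ := by
      have e : ((1 / α : ℝ) : ℂ) - 1 = ((1 / α - 1 : ℝ) : ℂ) := by push_cast; rfl
      rw [hG, norm_mul, norm_mul, norm_mul, norm_toComplex, hunit, mul_one, e,
        norm_cpow_ofReal hz0, norm_toComplex, Complex.norm_real, Complex.norm_real,
        Real.norm_of_nonneg hT0.le, Real.norm_of_nonneg (by positivity)]
      have h1 : B ≤ ‖x‖ ^ (1 / α - 1) :=
        Real.rpow_le_rpow (by positivity) hx.2.1 (by linarith)
      calc B = 1 * (1 * B) := by ring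
        _ ≤ T * (1 / α * ‖x‖ ^ (1 / α - 1)) := by gcongr; linarith
    have hG0 : G ≠ 0 := norm_pos_iff.1 (hB0.trans_le hGn)
    -- By the product rule the derivative is LG(1 + D) + LD', which is LG(1 + D + D'/G).
    refine ⟨D + D' / G, ?_, ?_⟩
    · calc ‖D + D' / G‖ ≤ C / T + C / T / B := by
            refine (norm_add_le _ _).trans (add_le_add hD ?_)
            rw [norm_div]
            gcongr
        _ = _ := by field_simp
    · simp only [partialDeriv, lineDeriv]
      rw [hl.deriv, hm.deriv]
      field_simp
      ring
  · have hDh : ‖D‖ ≤ 1 / 2 := by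
      refine hD.trans ?_
      rw [div_le_iff₀ hT0]; linarith
    have h1 : 1 / 2 ≤ ‖1 + D‖ := by
      have := norm_sub_norm_le (1 : ℂ) (-D)
      rw [norm_one, norm_neg, sub_neg_eq_add] at this
      linarith
    have hl : 1 / α * Real.exp (ε * T) ≤ ‖leadingTerm α τ x‖ := by
      rw [leadingTerm, norm_mul, Complex.norm_exp, norm_div, norm_one, Complex.norm_real,
        Real.norm_of_nonneg hα.le, Complex.re_ofReal_mul, mul_comm ε]
      gcongr
      exact hx.2.2.2
    rw [heq, norm_mul]
    calc 1 / (2 * α) * Real.exp (ε * T) = 1 / α * Real.exp (ε * T) * (1 / 2) := by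
          field_simp
      _ ≤ _ := by gcongr
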